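/- Let $\Bbbk$ be a field of characteristic different from $2$. Let $\mathcal{Q}\mathit{Sym}$ be the graded Hopf algebra over $\Bbbk$ of quasi-symmetric functions in the variables $x_1,x_2,\dots$, with linear basis the monomial quasi-symmetric functions $M_\alpha=\sum_{i_1<\cdots<i_k}x_{i_1}^{a_1}\cdots x_{i_k}^{a_k}$ indexed by all compositions $\alpha=(a_1,\dots,a_k)$ of all integers $n\ge 0$ (finite sequences of positive integers with sum $n$; $M_{()}=1$), graded by degree, with the product of power series and the coproduct $\Delta(M_\alpha)=\sum_{\alpha=\beta\gamma}M_\beta\otimes M_\gamma$ (sum over all ways to write $\alpha$ as a concatenation). Let $\zeta_{\mathcal Q}:\mathcal{Q}\mathit{Sym}\to\Bbbk$ be the character that sets $x_1=1$ and $x_i=0$ for $i\ne 1$. Characters form a group under convolution, and for a character $\varphi$ let $\bar\varphi(h)=(-1)^n\varphi(h)$ for $h$ homogeneous of degree $n$. Put $\nu_{\mathcal Q}=\bar\zeta_{\mathcal Q}^{-1}\zeta_{\mathcal Q}$. Let $\Pi_-$, the odd subalgebra of $(\mathcal{Q}\mathit{Sym},\zeta_{\mathcal Q})$, be the largest graded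 subcoalgebra of $\mathcal{Q}\mathit{Sym}$ on which $\bar\zeta_{\mathcal Q}$ and $\zeta_{\mathcal Q}^{-1}$ agree. Then the following hold. 1. There is a unique morphism of graded Hopf algebras $\Theta:\mathcal{Q}\mathit{Sym}\to\mathcal{Q}\mathit{Sym}$ such that $\zeta_{\mathcal Q}\circ\Theta=\nu_{\mathcal Q}$, and $\Pi_-$ equals its image $\Theta(\mathcal{Q}\mathit{Sym})$, which is Stembridge's peak Hopf algebra. 2. For a composition $\beta$ of $n$ put $\eta_\beta=\sum_{\alpha\le\beta}2^{k(\alpha)}M_\alpha$, where $k(\alpha)$ is the number of parts of $\alpha$, and $\alpha\le\beta$ means that $\alpha$ is a composition of $n$ whose set of partial sums is contained in that of $\beta$ (that is, $\beta$ refines $\alpha$). The family of all $\eta_\beta$, for $\beta$ a composition of some $n\ge 0$ all of whose parts are odd (the empty composition included), is a linear basis of $\Pi_-$. -/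

import Mathlib

noncomputable section

open scoped TensorProduct

namespace QuasiSymmetric

/-- The sequence of nonzero exponents of the monomial `x ^ d`, read in increasing order of the
variables: for `x ^ d = x_{i₁} ^ {a₁} ⋯ x_{iₖ} ^ {aₖ}` with `i₁ < ⋯ < iₖ` and all `aⱼ > 0` it is
`[a₁, …, aₖ]`. -/
def exponents (d : ℕ →₀ ℕ) : List ℕ := (d.support.sort (· ≤ ·)).map d

/-- The exponent vector of `x_0 ^ {a₁} x_1 ^ {a₂} ⋯ x_{k-1} ^ {aₖ}`. -/
def packed (w : List ℕ+) : ℕ →₀ ℕ := (w.map ((↑) : ℕ+ → ℕ)).toFinsupp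

theorem exponents_embDomain (φ : ℕ ↪o ℕ) (d : ℕ →₀ ℕ) :
    exponents (d.embDomain φ.toEmbedding) = exponents d := by
  unfold exponents
  rw [Finsupp.support_embDomain]
  have h : (d.support.map φ.toEmbedding).sort (· ≤ ·) = (d.support.sort (· ≤ ·)).map φ := by
    symm
    exact Finset.map_sort (r := (· ≤ ·)) (r' := (· ≤ ·)) φ.toEmbedding d.support
      (fun a _ b _ => by simp)
  rw [h, List.map_map]
  congr 1
  funext i
  exact Finsupp.embDomain_apply_self φ.toEmbedding d i

theorem exists_parts (d : ℕ →₀ ℕ) :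
    ∃ w : List ℕ+, w.map ((↑) : ℕ+ → ℕ) = exponents d := by
  have h : ∀ a ∈ exponents d, 0 < a := by
    intro a ha
    obtain ⟨i, hi, rfl⟩ := List.mem_map.1 ha
    rw [Finset.mem_sort] at hi
    exact Nat.pos_of_ne_zero (Finsupp.mem_support_iff.1 hi)
  exact ⟨(exponents d).pmap (fun a ha => Nat.toPNat a ha) h, by
    rw [List.map_pmap]; exact List.pmap_eq_self.2 fun _ _ => rfl⟩

theorem packed_support (w : List ℕ+) : (packed w).support = Finset.range w.length := by
  ext i
  rw [Finsupp.mem_support_iff, Finset.mem_range, packed, List.toFinsupp_apply]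
  by_cases h : i < w.length
  · simp [h]
  · simp [h]

theorem packed_apply (w : List ℕ+) (i : ℕ) (h : i < w.length) : packed w i = (w[i] : ℕ) := by
  simp [packed, List.toFinsupp_apply, h]

theorem exponents_packed (w : List ℕ+) : exponents (packed w) = w.map ((↑) : ℕ+ → ℕ) := by
  unfold exponents
  rw [packed_support, Finset.sort_range]
  apply List.ext_getElem
  · simp
  · intro i h1 h2
    simp only [List.length_map, List.length_range] at h1
    simp [packed_apply, h1]

theorem exists_embDomain (d : ℕ →₀ ℕ) (w : List ℕ+) (hw : w.map ((↑) : ℕ+ → ℕ) = exponents d) :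
    ∃ φ : ℕ ↪o ℕ, (packed w).embDomain φ.toEmbedding = d := by
  have hk : d.support.card = w.length := by
    have := congrArg List.length hw
    simp [exponents] at this
    omega
  let e := d.support.orderEmbOfFin hk
  let f : ℕ → ℕ := fun i => if h : i < w.length then e ⟨i, h⟩ else d.support.sup id + 1 + i
  have hf : StrictMono f := by
    intro i j hij
    simp only [f]
    by_cases hj : j < w.length
    · have hi : i < w.length := hij.trans hj
      simp only [hi, hj, dif_pos]
      exact e.strictMono hij
    · by_cases hi : i < w.length
      · simp only [hi, hj, dif_pos, dif_neg, not_false_iff]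
        have : e ⟨i, hi⟩ ≤ d.support.sup id :=
          Finset.le_sup (f := id) (Finset.orderEmbOfFin_mem _ hk _)
        omega
      · simp only [hi, hj, dif_neg, not_false_iff]
        omega
  let φ : ℕ ↪o ℕ := OrderEmbedding.ofStrictMono f hf
  have hφ : ∀ i, φ i = f i := fun i => rfl
  refine ⟨φ, ?_⟩
  have key : ∀ i (h : i < w.length), packed w i = d (e ⟨i, h⟩) := by
    intro i h
    rw [packed_apply w i h]
    have h2 : (w.map ((↑) : ℕ+ → ℕ))[i]'(by simpa using h) = (exponents d)[i]'(by
      rw [← hw]; simpa using h) := by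
      simp only [hw]
    rw [List.getElem_map] at h2
    rw [h2]
    simp only [exponents, List.getElem_map, e, Finset.orderEmbOfFin_apply]
    rfl
  ext j
  by_cases hj : j ∈ d.support
  · have : j ∈ Set.range e := by
      rw [Finset.range_orderEmbOfFin]; exact hj
    obtain ⟨⟨i, hi⟩, rfl⟩ := this
    have h1 : e ⟨i, hi⟩ = φ.toEmbedding i := by
      change _ = f i
      simp [f, hi]
    rw [← key i hi, h1, Finsupp.embDomain_apply_self]
  · rw [Finsupp.notMem_support_iff.1 hj]
    by_contra h0
    have h1 : j ∈ ((packed w).embDomain φ.toEmbedding).support := Finsupp.mem_support_iff.2 h0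
    rw [Finsupp.support_embDomain, packed_support, Finset.mem_map] at h1
    obtain ⟨i, hi, rfl⟩ := h1
    rw [Finset.mem_range] at hi
    apply hj
    change f i ∈ _
    simp only [f, hi, dif_pos]
    exact Finset.orderEmbOfFin_mem _ hk _

theorem exponents_sum (d : ℕ →₀ ℕ) : (exponents d).sum = d.degree := by
  rw [Finsupp.degree_apply, ← Finset.sum_map_toList]
  exact ((Finset.sort_perm_toList _ _).map d).sum_eq

end QuasiSymmetric

open MvPowerSeries QuasiSymmetric

/-- The algebra `QSym` of quasi-symmetric functions over `k`: the power series of bounded degree in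
`x_0, x_1, x_2, …` in which the coefficients of `x_{i₁} ^ {a₁} ⋯ x_{iₘ} ^ {aₘ}` and
`x_{j₁} ^ {a₁} ⋯ x_{jₘ} ^ {aₘ}` agree whenever `i₁ < ⋯ < iₘ` and `j₁ < ⋯ < jₘ`. -/
def QSym (k : Type*) [CommRing k] : Subalgebra k (MvPowerSeries ℕ k) where
  carrier := {f | (∃ N : ℕ, ∀ d : ℕ →₀ ℕ, coeff d f ≠ 0 → d.degree ≤ N) ∧
    ∀ (φ : ℕ ↪o ℕ) (d : ℕ →₀ ℕ), coeff (d.embDomain φ.toEmbedding) f = coeff d f}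
  mul_mem' := by
    rintro f g ⟨⟨N, hN⟩, hf⟩ ⟨⟨N', hN'⟩, hg⟩
    refine ⟨⟨N + N', fun d hd => ?_⟩, fun φ d => ?_⟩
    · rw [coeff_mul] at hd
      obtain ⟨p, hp, hne⟩ := Finset.exists_ne_zero_of_sum_ne_zero hd
      rw [Finset.HasAntidiagonal.mem_antidiagonal] at hp
      have h1 := hN p.1 (left_ne_zero_of_mul hne)
      have h2 := hN' p.2 (right_ne_zero_of_mul hne)
      rw [← hp, map_add]
      omega
    · have hf' : killCompl φ.toEmbedding f = f := by
        ext d; rw [coeff_killCompl]; exact hf φ d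
      have hg' : killCompl φ.toEmbedding g = g := by
        ext d; rw [coeff_killCompl]; exact hg φ d
      rw [← coeff_killCompl, map_mul, hf', hg']
  add_mem' := by
    rintro f g ⟨⟨N, hN⟩, hf⟩ ⟨⟨N', hN'⟩, hg⟩
    refine ⟨⟨N + N', fun d hd => ?_⟩, fun φ d => by rw [map_add, map_add, hf, hg]⟩
    by_contra h
    apply hd
    have h1 : coeff d f = 0 := by
      by_contra h1; have := hN d h1; omega
    have h2 : coeff d g = 0 := by
      by_contra h2; have := hN' d h2; omega
    rw [map_add, h1, h2, add_zero]
  algebraMap_mem' := by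
    classical
    intro r
    rw [MvPowerSeries.algebraMap_apply]
    refine ⟨⟨0, fun d hd => ?_⟩, fun φ d => ?_⟩
    · rw [coeff_C] at hd
      have : d = 0 := by by_contra h; simp [h] at hd
      simp [this]
    · rw [← coeff_killCompl, killCompl_C]

namespace QSym

variable {k : Type*} [CommRing k]

theorem coeff_eq_packed (f : QSym k) (d : ℕ →₀ ℕ) (w : List ℕ+)
    (hw : w.map ((↑) : ℕ+ → ℕ) = exponents d) :
    coeff d (f : MvPowerSeries ℕ k) = coeff (packed w) (f : MvPowerSeries ℕ k) := by
  obtain ⟨φ, rfl⟩ := exists_embDomain d w hw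
  exact f.2.2 φ _

variable (k) in
/-- The monomial quasi-symmetric function `M_α = ∑_{i₁ < ⋯ < iₘ} x_{i₁} ^ {a₁} ⋯ x_{iₘ} ^ {aₘ}`
of the composition `α = (a₁, …, aₘ)`: the coefficient of `x ^ d` is `1` if the nonzero exponents of
`x ^ d`, in increasing order of the variables, are `a₁, …, aₘ`, and `0` otherwise. -/
def M (w : List ℕ+) : QSym k :=
  ⟨(fun d => if exponents d = w.map ((↑) : ℕ+ → ℕ) then 1 else 0 : MvPowerSeries ℕ k), by
    refine ⟨⟨(w.map ((↑) : ℕ+ → ℕ)).sum, fun d hd => ?_⟩, fun φ d => ?_⟩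
    · by_cases h : exponents d = w.map ((↑) : ℕ+ → ℕ)
      · rw [← h, exponents_sum]
      · exact absurd (if_neg h) hd
    · change (if _ then _ else _) = (if _ then _ else _)
      rw [exponents_embDomain]⟩

theorem coeff_M (w : List ℕ+) (d : ℕ →₀ ℕ) : coeff d (M k w : MvPowerSeries ℕ k) =
    if exponents d = w.map ((↑) : ℕ+ → ℕ) then 1 else 0 := rfl

theorem map_coe_inj {w v : List ℕ+} :
    w.map ((↑) : ℕ+ → ℕ) = v.map ((↑) : ℕ+ → ℕ) ↔ w = v :=
  (List.map_injective_iff.2 PNat.coe_injective).eq_iff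

theorem coeff_packed_M (w v : List ℕ+) : coeff (packed v) (M k w : MvPowerSeries ℕ k) =
    if v = w then 1 else 0 := by
  rw [coeff_M, exponents_packed]
  simp only [map_coe_inj]

theorem finite_sum_le (N : ℕ) : {w : List ℕ+ | (w.map ((↑) : ℕ+ → ℕ)).sum ≤ N}.Finite := by
  have h : ∀ n : ℕ, {w : List ℕ+ | (w.map ((↑) : ℕ+ → ℕ)).sum = n}.Finite := by
    intro n
    apply Set.Finite.of_finite_image (f := List.map ((↑) : ℕ+ → ℕ)) _
      (List.map_injective_iff.2 PNat.coe_injective).injOn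
    apply (Set.finite_range (fun c : Composition n => c.blocks)).subset
    rintro _ ⟨w, hw, rfl⟩
    exact ⟨⟨w.map ((↑) : ℕ+ → ℕ), fun hi => by
      obtain ⟨a, _, rfl⟩ := List.mem_map.1 hi; exact a.pos, hw⟩, rfl⟩
  have h2 : {w : List ℕ+ | (w.map ((↑) : ℕ+ → ℕ)).sum ≤ N} =
      ⋃ n ∈ Set.Iic N, {w : List ℕ+ | (w.map ((↑) : ℕ+ → ℕ)).sum = n} := by
    ext w; simp
  rw [h2]
  exact (Set.finite_Iic N).biUnion fun n _ => h n

theorem packed_degree (w : List ℕ+) : (packed w).degree = (w.map ((↑) : ℕ+ → ℕ)).sum := by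
  rw [← exponents_sum, exponents_packed]

theorem support_coords_finite (f : QSym k) :
    (Function.support fun w : List ℕ+ => coeff (packed w) (f : MvPowerSeries ℕ k)).Finite := by
  obtain ⟨N, hN⟩ := f.2.1
  refine (finite_sum_le N).subset fun w hw => ?_
  rw [Set.mem_ofPred_eq, ← packed_degree]
  exact hN _ hw

/-- The coefficients of a quasi-symmetric function at the monomials
`x_0 ^ {a₁} x_1 ^ {a₂} ⋯ x_{k-1} ^ {aₖ}`. -/
def coords : QSym k →ₗ[k] (List ℕ+ →₀ k) where
  toFun f := Finsupp.ofSupportFinite _ (support_coords_finite f)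
  map_add' f g := by ext w; simp [Finsupp.ofSupportFinite_coe]
  map_smul' r f := by ext w; simp [Finsupp.ofSupportFinite_coe]

theorem coords_apply (f : QSym k) (w : List ℕ+) :
    coords f w = coeff (packed w) (f : MvPowerSeries ℕ k) := rfl

theorem ext_packed {f g : QSym k} (h : ∀ w, coeff (packed w) (f : MvPowerSeries ℕ k) =
    coeff (packed w) (g : MvPowerSeries ℕ k)) : f = g := by
  apply Subtype.ext
  ext d
  obtain ⟨w, hw⟩ := exists_parts d
  rw [coeff_eq_packed f d w hw, coeff_eq_packed g d w hw, h]

theorem coords_bijective : Function.Bijective (coords (k := k)) := by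
  refine ⟨fun f g hfg => ext_packed fun w => DFunLike.congr_fun hfg w, fun c => ?_⟩
  refine ⟨∑ w ∈ c.support, c w • M k w, ?_⟩
  rw [map_sum]
  ext v
  simp only [map_smul, Finsupp.coe_finsetSum, Finset.sum_apply, Finsupp.smul_apply, coords_apply,
    coeff_packed_M]
  simp +contextual [eq_comm]

variable (k) in
/-- The monomial quasi-symmetric functions form a linear basis of `QSym`; lists of positive integers
are the compositions of all `n ≥ 0`. -/
def basis : Module.Basis (List ℕ+) k (QSym k) := Module.Basis.ofRepr (LinearEquiv.ofBijective coords coords_bijective)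

theorem basis_repr (f : QSym k) (w : List ℕ+) :
    (basis k).repr f w = coeff (packed w) (f : MvPowerSeries ℕ k) := rfl

@[simp] theorem basis_apply (w : List ℕ+) : basis k w = M k w := by
  apply (basis k).repr.injective
  ext v
  rw [Module.Basis.repr_self, basis_repr, coeff_packed_M, Finsupp.single_apply]
  simp [eq_comm]

theorem sum_deconcatenations (w u v : List ℕ+) :
    (∑ i ∈ Finset.range (w.length + 1), if u = w.take i ∧ v = w.drop i then (1 : k) else 0) =
      if u ++ v = w then 1 else 0 := by
  by_cases h : u ++ v = w
  · subst h
    rw [if_pos rfl, Finset.sum_eq_single u.length]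
    · simp
    · intro i hi hne
      rw [if_neg]
      rintro ⟨h1, h2⟩
      have := congrArg List.length h1
      simp at this hi
      omega
    · intro h; simp at h
  · rw [if_neg h]
    apply Finset.sum_eq_zero
    intro i _
    rw [if_neg]
    rintro ⟨rfl, rfl⟩
    exact h (List.take_append_drop i w)

/-- The coproduct `Δ(M_α) = ∑_{α = βγ} M_β ⊗ M_γ`, the sum over all deconcatenations of `α`; the
counit is the constant term. -/
instance : CoalgebraStruct k (QSym k) where
  comul := (basis k).constr k fun w =>
    ∑ i ∈ Finset.range (w.length + 1), M k (w.take i) ⊗ₜ[k] M k (w.drop i)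
  counit :=
    { toFun := fun f => constantCoeff (f : MvPowerSeries ℕ k)
      map_add' := fun f g => by simp
      map_smul' := fun r f => by simp }

theorem comul_M (w : List ℕ+) : Coalgebra.comul (R := k) (M k w) =
    ∑ i ∈ Finset.range (w.length + 1), M k (w.take i) ⊗ₜ[k] M k (w.drop i) := by
  rw [← basis_apply]
  exact (basis k).constr_basis k _ w

theorem counit_apply (f : QSym k) : Coalgebra.counit (R := k) f =
    constantCoeff (f : MvPowerSeries ℕ k) := rfl

theorem packed_nil : packed [] = 0 := by
  have := packed_support []
  simpa using this

theorem counit_M (w : List ℕ+) : Coalgebra.counit (R := k) (M k w) = if w = [] then 1 else 0 := by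
  rw [counit_apply, ← coeff_zero_eq_constantCoeff_apply, ← packed_nil, coeff_packed_M]
  simp [eq_comm]

theorem M_nil : M k [] = 1 := by
  classical
  apply ext_packed
  intro w
  rw [coeff_packed_M]
  have h : packed w = 0 ↔ w = [] := by
    constructor
    · intro h
      have := packed_support w
      rw [h] at this
      simpa using this.symm
    · rintro rfl; exact packed_nil
  simp [coeff_one, h]

instance : Coalgebra k (QSym k) where
  coassoc := by
    apply (basis k).ext
    intro w
    simp only [LinearMap.comp_apply, basis_apply, comul_M, map_sum, LinearMap.rTensor_tmul,
      LinearMap.lTensor_tmul, LinearEquiv.coe_coe, TensorProduct.sum_tmul, TensorProduct.tmul_sum,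
      TensorProduct.assoc_tmul]
    rw [Finset.sum_sigma', Finset.sum_sigma']
    refine Finset.sum_nbij' (fun p => ⟨p.2, p.1 - p.2⟩) (fun p => ⟨p.1 + p.2, p.1⟩) ?_ ?_ ?_ ?_ ?_
    · rintro ⟨i, j⟩ h
      simp at h ⊢
      omega
    · rintro ⟨i, j⟩ h
      simp at h ⊢
      omega
    · rintro ⟨i, j⟩ h
      simp at h ⊢
      omega
    · rintro ⟨i, j⟩ h
      simp at h ⊢
    · rintro ⟨i, j⟩ h
      simp at h
      have h1 : min j i = j := by omega
      have h2 : j + (i - j) = i := by omega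
      simp only [List.take_take, List.drop_drop, List.drop_take, h1, h2]
  rTensor_counit_comp_comul := by
    apply (basis k).ext
    intro w
    simp only [LinearMap.comp_apply, basis_apply, comul_M, map_sum, LinearMap.rTensor_tmul,
      counit_M, TensorProduct.mk_apply]
    rw [Finset.sum_eq_single 0]
    · simp
    · intro i hi h0
      have : w.take i ≠ [] := by
        intro h
        rw [List.take_eq_nil_iff] at h
        simp at hi
        rcases h with h | h
        · exact h0 h
        · subst h; simp at hi; omega
      rw [if_neg this]; simp
    · simp
  lTensor_counit_comp_comul := by
    apply (basis k).ext
    intro w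
    simp only [LinearMap.comp_apply, basis_apply, comul_M, map_sum, LinearMap.lTensor_tmul,
      counit_M, LinearMap.flip_apply, TensorProduct.mk_apply]
    rw [Finset.sum_eq_single w.length]
    · simp
    · intro i hi h0
      have : w.drop i ≠ [] := by
        intro h
        rw [List.drop_eq_nil_iff] at h
        simp at hi
        omega
      rw [if_neg this]; simp
    · simp

/-- For `N` fixed, the embedding of variables `x_0, …, x_{N-1}, y_0, y_1, … ↦ x_0, x_1, …`. -/
def splitEmb (N : ℕ) : Fin N ⊕ ℕ ↪ ℕ where
  toFun := Sum.elim (fun i => i) (fun j => N + j)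
  inj' := by
    rintro (i | i) (j | j) h
    · simpa [Fin.ext_iff] using h
    · have := i.2; simp at h; omega
    · have := j.2; simp at h; omega
    · simpa using h

/-- `f ⊗ g ↦ f(x_0, …, x_{N-1}) g(y_0, y_1, …)`. -/
def splitMap (N : ℕ) : QSym k ⊗[k] QSym k →ₐ[k] MvPowerSeries (Fin N ⊕ ℕ) k :=
  Algebra.TensorProduct.lift
    ((rename (Function.Embedding.inl : Fin N ↪ Fin N ⊕ ℕ)).comp
      ((killCompl Fin.valEmbedding).comp (QSym k).val))
    ((rename (Function.Embedding.inr : ℕ ↪ Fin N ⊕ ℕ)).comp (QSym k).val)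
    (fun _ _ => Commute.all _ _)

theorem coeff_rename_inl_mul_rename_inr {σ τ : Type*} (a : MvPowerSeries σ k)
    (b : MvPowerSeries τ k) (d : σ →₀ ℕ) (e : τ →₀ ℕ) :
    coeff (d.embDomain Function.Embedding.inl + e.embDomain Function.Embedding.inr)
      (rename (Function.Embedding.inl : σ ↪ σ ⊕ τ) a *
        rename (Function.Embedding.inr : τ ↪ σ ⊕ τ) b) = coeff d a * coeff e b := by
  classical
  have hl : ∀ (x : σ →₀ ℕ) (j : τ),
      (x.embDomain (Function.Embedding.inl : σ ↪ σ ⊕ τ)) (Sum.inr j) = 0 := fun x j =>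
    Finsupp.embDomain_of_notMem_range _ _ _ (by simp)
  have hr : ∀ (x : τ →₀ ℕ) (j : σ),
      (x.embDomain (Function.Embedding.inr : τ ↪ σ ⊕ τ)) (Sum.inl j) = 0 := fun x j =>
    Finsupp.embDomain_of_notMem_range _ _ _ (by simp)
  have hl' : ∀ (x : σ →₀ ℕ) (j : σ),
      (x.embDomain (Function.Embedding.inl : σ ↪ σ ⊕ τ)) (Sum.inl j) = x j := fun x j =>
    Finsupp.embDomain_apply_self Function.Embedding.inl x j
  have hr' : ∀ (x : τ →₀ ℕ) (j : τ),
      (x.embDomain (Function.Embedding.inr : τ ↪ σ ⊕ τ)) (Sum.inr j) = x j := fun x j =>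
    Finsupp.embDomain_apply_self Function.Embedding.inr x j
  rw [coeff_mul, Finset.sum_eq_single (d.embDomain Function.Embedding.inl,
    e.embDomain Function.Embedding.inr)]
  · rw [coeff_embDomain_rename, coeff_embDomain_rename]
  · rintro ⟨p, q⟩ hp hne
    rw [Finset.HasAntidiagonal.mem_antidiagonal] at hp
    by_cases h1 : p ∈ Set.range (Finsupp.embDomain (Function.Embedding.inl : σ ↪ σ ⊕ τ))
    · by_cases h2 : q ∈ Set.range (Finsupp.embDomain (Function.Embedding.inr : τ ↪ σ ⊕ τ))
      · obtain ⟨x, rfl⟩ := h1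
        obtain ⟨y, rfl⟩ := h2
        exfalso
        apply hne
        simp only at hp
        have hx : x = d := by
          ext j
          have := DFunLike.congr_fun hp (Sum.inl j)
          simpa [hl', hr] using this
        have hy : y = e := by
          ext j
          have := DFunLike.congr_fun hp (Sum.inr j)
          simpa [hr', hl] using this
        rw [hx, hy]
      · have : coeff q (rename (Function.Embedding.inr : τ ↪ σ ⊕ τ) b) = 0 := by
          apply coeff_rename_eq_zero
          rintro ⟨y, hy⟩
          exact h2 ⟨y, by rw [Finsupp.embDomain_eq_mapDomain]; exact hy⟩
        simp only [this, mul_zero]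
    · have : coeff p (rename (Function.Embedding.inl : σ ↪ σ ⊕ τ) a) = 0 := by
        apply coeff_rename_eq_zero
        rintro ⟨y, hy⟩
        exact h1 ⟨y, by rw [Finsupp.embDomain_eq_mapDomain]; exact hy⟩
      simp only [this, zero_mul]
  · intro h
    apply absurd _ h
    rw [Finset.HasAntidiagonal.mem_antidiagonal]

theorem coeff_splitMap_tmul (N : ℕ) (f g : QSym k) (d : Fin N →₀ ℕ) (e : ℕ →₀ ℕ) :
    coeff (d.embDomain Function.Embedding.inl + e.embDomain Function.Embedding.inr)
      (splitMap N (f ⊗ₜ g)) = coeff (d.embDomain Fin.valEmbedding) (f : MvPowerSeries ℕ k) *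
        coeff e (g : MvPowerSeries ℕ k) := by
  rw [← coeff_killCompl, ← coeff_rename_inl_mul_rename_inr]
  rfl

theorem exponents_add (d e : ℕ →₀ ℕ) (h : ∀ a ∈ d.support, ∀ b ∈ e.support, a < b) :
    exponents (d + e) = exponents d ++ exponents e := by
  classical
  have hdisj : Disjoint d.support e.support := by
    rw [Finset.disjoint_left]
    intro a ha hb
    exact lt_irrefl _ (h a ha a hb)
  have hs : (d + e).support.sort (· ≤ ·) =
      d.support.sort (· ≤ ·) ++ e.support.sort (· ≤ ·) := by
    have h1 : (d + e).support = (d.support.sort (· ≤ ·) ++ e.support.sort (· ≤ ·)).toFinset := by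
      rw [Finsupp.support_add_eq hdisj, List.toFinset_append, Finset.sort_toFinset,
        Finset.sort_toFinset]
    rw [h1, List.toFinset_sort]
    · rw [List.pairwise_append]
      refine ⟨Finset.pairwise_sort _ _, Finset.pairwise_sort _ _, fun a ha b hb => ?_⟩
      rw [Finset.mem_sort] at ha hb
      exact (h a ha b hb).le
    · rw [List.nodup_append]
      refine ⟨Finset.sort_nodup _ _, Finset.sort_nodup _ _, fun a ha b hb => ?_⟩
      rw [Finset.mem_sort] at ha hb
      exact (h a ha b hb).ne
  unfold exponents
  rw [hs, List.map_append]
  congr 1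
  · apply List.map_congr_left
    intro a ha
    rw [Finset.mem_sort] at ha
    have : e a = 0 := Finsupp.notMem_support_iff.1 (Finset.disjoint_left.1 hdisj ha)
    simp [this]
  · apply List.map_congr_left
    intro a ha
    rw [Finset.mem_sort] at ha
    have : d a = 0 := Finsupp.notMem_support_iff.1 (Finset.disjoint_right.1 hdisj ha)
    simp [this]

theorem exponents_split (N : ℕ) (d : Fin N →₀ ℕ) (e : ℕ →₀ ℕ) :
    exponents ((d.embDomain Function.Embedding.inl +
      e.embDomain Function.Embedding.inr : Fin N ⊕ ℕ →₀ ℕ).embDomain (splitEmb N)) =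
      exponents (d.embDomain Fin.valEmbedding) ++ exponents e := by
  let φ : ℕ ↪o ℕ := OrderEmbedding.ofStrictMono (fun j => N + j) (fun _ _ h => by simpa using h)
  rw [← exponents_embDomain φ e, ← exponents_add]
  · congr 1
    rw [Finsupp.embDomain_eq_mapDomain, Finsupp.mapDomain_add]
    simp only [Finsupp.embDomain_eq_mapDomain, ← Finsupp.mapDomain_comp]
    rfl
  · intro a ha b hb
    rw [Finsupp.support_embDomain, Finset.mem_map] at ha hb
    obtain ⟨i, -, rfl⟩ := ha
    obtain ⟨j, -, rfl⟩ := hb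
    have : (i : ℕ) < N + j := by have := i.2; omega
    exact this

theorem exists_split {σ τ : Type*} (d : σ ⊕ τ →₀ ℕ) : ∃ (x : σ →₀ ℕ) (y : τ →₀ ℕ),
    x.embDomain Function.Embedding.inl + y.embDomain Function.Embedding.inr = d := by
  refine ⟨d.comapDomain Sum.inl Sum.inl_injective.injOn,
    d.comapDomain Sum.inr Sum.inr_injective.injOn, ?_⟩
  ext (i | j)
  · rw [Finsupp.add_apply, Finsupp.embDomain_of_notMem_range Function.Embedding.inr _ _ (by simp),
      add_zero]
    exact Finsupp.embDomain_apply_self Function.Embedding.inl _ i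
  · rw [Finsupp.add_apply, Finsupp.embDomain_of_notMem_range Function.Embedding.inl _ _ (by simp),
      zero_add]
    exact Finsupp.embDomain_apply_self Function.Embedding.inr _ j

theorem splitMap_comul (N : ℕ) (f : QSym k) : splitMap N (Coalgebra.comul (R := k) f) =
    killCompl (splitEmb N) (f : MvPowerSeries ℕ k) := by
  have h : (splitMap (k := k) N).toLinearMap ∘ₗ Coalgebra.comul (R := k) =
      ((killCompl (splitEmb N)).comp (QSym k).val).toLinearMap := by
    apply (basis k).ext
    intro w
    ext d
    obtain ⟨x, y, rfl⟩ := exists_split d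
    obtain ⟨u, hu⟩ := exists_parts (x.embDomain Fin.valEmbedding)
    obtain ⟨v, hv⟩ := exists_parts y
    simp only [LinearMap.comp_apply, basis_apply, comul_M, map_sum, AlgHom.toLinearMap_apply,
      AlgHom.comp_apply, coeff_splitMap_tmul, coeff_M, coeff_killCompl, Subalgebra.val_apply,
      exponents_split, ← hu, ← hv, ← List.map_append, map_coe_inj]
    rw [← sum_deconcatenations]
    apply Finset.sum_congr rfl
    intro i _
    rw [ite_and]
    split_ifs <;> simp
  exact LinearMap.congr_fun h f

theorem splitMap_injective {s t : QSym k ⊗[k] QSym k} (h : ∀ N, splitMap N s = splitMap N t) :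
    s = t := by
  apply ((basis k).tensorProduct (basis k)).repr.injective
  ext ⟨u, v⟩
  have hu : ∃ x : Fin u.length →₀ ℕ, x.embDomain Fin.valEmbedding = packed u := by
    refine ⟨(packed u).comapDomain Fin.valEmbedding Fin.valEmbedding.injective.injOn, ?_⟩
    apply Finsupp.embDomain_comapDomain
    intro i hi
    rw [Finset.mem_coe, packed_support, Finset.mem_range] at hi
    exact ⟨⟨i, hi⟩, rfl⟩
  obtain ⟨x, hx⟩ := hu
  have key : ∀ t : QSym k ⊗[k] QSym k, ((basis k).tensorProduct (basis k)).repr t (u, v) =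
      coeff (x.embDomain Function.Embedding.inl + (packed v).embDomain Function.Embedding.inr)
        (splitMap u.length t) := by
    intro t
    induction t with
    | zero => simp
    | add a b ha hb => simp only [map_add, Finsupp.add_apply, ha, hb]
    | tmul f g =>
      rw [coeff_splitMap_tmul, hx, Module.Basis.tensorProduct_repr_tmul_apply, basis_repr,
        basis_repr]
      simp [mul_comm]
  rw [key, key, h]

instance : Bialgebra k (QSym k) :=
  Bialgebra.mk' k (QSym k)
    (by simp [counit_apply])
    (by simp [counit_apply])
    (by rw [← M_nil, comul_M]; simp [M_nil]; rfl)
    (by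
      intro f g
      apply splitMap_injective
      intro N
      rw [splitMap_comul, map_mul (splitMap (k := k) N), splitMap_comul, splitMap_comul, Subalgebra.coe_mul,
        map_mul])

/-- The antipode of `QSym` on the basis `M`, by the recursion that the antipode axiom forces. -/
def antipodeM : List ℕ+ → QSym k
  | [] => 1
  | a :: w => - ∑ i : Fin (w.length + 1), antipodeM ((a :: w).take i) * M k ((a :: w).drop i)
termination_by w => w.length
decreasing_by simp; omega

/-- The right-handed counterpart of `antipodeM`. -/
def antipodeM' : List ℕ+ → QSym k
  | [] => 1
  | a :: w => - ∑ i : Fin (w.length + 1),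
      M k ((a :: w).take (i + 1)) * antipodeM' ((a :: w).drop (i + 1))
termination_by w => w.length
decreasing_by simp

theorem antipodeM_sum (w : List ℕ+) : ∑ i ∈ Finset.range (w.length + 1),
    antipodeM (w.take i) * M k (w.drop i) = if w = [] then 1 else 0 := by
  cases w with
  | nil => simp [antipodeM, M_nil]
  | cons a w =>
    rw [Finset.sum_range_succ, List.length_cons, ← List.length_cons (a := a), List.take_length,
      List.drop_length, antipodeM, M_nil, List.length_cons, Finset.sum_range]
    simp

theorem antipodeM'_sum (w : List ℕ+) : ∑ i ∈ Finset.range (w.length + 1),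
    M k (w.take i) * antipodeM' (w.drop i) = if w = [] then 1 else 0 := by
  cases w with
  | nil => simp [antipodeM', M_nil]
  | cons a w =>
    rw [Finset.sum_range_succ', List.take_zero, List.drop_zero, antipodeM', M_nil,
      List.length_cons, Finset.sum_range]
    simp

/-- The antipode of `QSym`. -/
def antipodeAux : QSym k →ₗ[k] QSym k := (basis k).constr k antipodeM

/-- The right convolution inverse of the identity of `QSym`. -/
def antipodeAux' : QSym k →ₗ[k] QSym k := (basis k).constr k antipodeM'

theorem antipodeAux_M (w : List ℕ+) : antipodeAux (M k w) = antipodeM w := by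
  rw [← basis_apply]; exact (basis k).constr_basis k _ w

theorem antipodeAux'_M (w : List ℕ+) : antipodeAux' (M k w) = antipodeM' w := by
  rw [← basis_apply]; exact (basis k).constr_basis k _ w

theorem antipodeAux_left : LinearMap.mul' k (QSym k) ∘ₗ antipodeAux.rTensor (QSym k) ∘ₗ
    Coalgebra.comul = Algebra.linearMap k (QSym k) ∘ₗ Coalgebra.counit := by
  apply (basis k).ext
  intro w
  simp only [LinearMap.comp_apply, basis_apply, comul_M, map_sum, LinearMap.rTensor_tmul,
    LinearMap.mul'_apply, antipodeAux_M, antipodeM_sum, counit_M, Algebra.linearMap_apply]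
  split_ifs <;> simp

theorem antipodeAux_right : LinearMap.mul' k (QSym k) ∘ₗ antipodeAux'.lTensor (QSym k) ∘ₗ
    Coalgebra.comul = Algebra.linearMap k (QSym k) ∘ₗ Coalgebra.counit := by
  apply (basis k).ext
  intro w
  simp only [LinearMap.comp_apply, basis_apply, comul_M, map_sum, LinearMap.lTensor_tmul,
    LinearMap.mul'_apply, antipodeAux'_M, antipodeM'_sum, counit_M, Algebra.linearMap_apply]
  split_ifs <;> simp

theorem antipodeAux_eq : (antipodeAux : QSym k →ₗ[k] QSym k) = antipodeAux' := by
  apply WithConv.toConv_injective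
  apply left_inv_eq_right_inv (a := WithConv.toConv (LinearMap.id : QSym k →ₗ[k] QSym k))
  · exact congrArg WithConv.toConv antipodeAux_left
  · exact congrArg WithConv.toConv antipodeAux_right

/-- The Hopf algebra of quasi-symmetric functions. -/
instance : HopfAlgebra k (QSym k) where
  antipode := antipodeAux
  mul_antipode_rTensor_comul := antipodeAux_left
  mul_antipode_lTensor_comul := by
    rw [antipodeAux_eq]; exact antipodeAux_right

variable (k) in
/-- The homogeneous component `QSym_n`: the quasi-symmetric functions all of whose monomials have
degree `n`. -/
def homogeneous (n : ℕ) : Submodule k (QSym k) where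
  carrier := {f | ∀ d : ℕ →₀ ℕ, coeff d (f : MvPowerSeries ℕ k) ≠ 0 → d.degree = n}
  zero_mem' := fun d hd => absurd (by simp) hd
  add_mem' := by
    intro f g hf hg d hd
    by_contra h
    apply hd
    have h1 : coeff d (f : MvPowerSeries ℕ k) = 0 := by
      by_contra h1; exact h (hf d h1)
    have h2 : coeff d (g : MvPowerSeries ℕ k) = 0 := by
      by_contra h2; exact h (hg d h2)
    simp [h1, h2]
  smul_mem' := by
    intro r f hf d hd
    apply hf d
    intro h
    apply hd
    simp [h]

theorem M_mem_homogeneous (w : List ℕ+) :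
    M k w ∈ homogeneous k (w.map ((↑) : ℕ+ → ℕ)).sum := by
  intro d hd
  rw [coeff_M] at hd
  by_cases h : exponents d = w.map ((↑) : ℕ+ → ℕ)
  · rw [← h, exponents_sum]
  · exact absurd (if_neg h) hd

instance : SetLike.GradedMonoid (homogeneous k) where
  one_mem := by
    rw [← M_nil]
    exact M_mem_homogeneous []
  mul_mem := by
    intro i j f g hf hg d hd
    rw [Subalgebra.coe_mul, coeff_mul] at hd
    obtain ⟨p, hp, hne⟩ := Finset.exists_ne_zero_of_sum_ne_zero hd
    rw [Finset.HasAntidiagonal.mem_antidiagonal] at hp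
    rw [← hp, map_add, hf _ (left_ne_zero_of_mul hne), hg _ (right_ne_zero_of_mul hne)]

/-- The map sending `M_α` to itself in the component of degree `|α|`. -/
def decomposeAux : QSym k →ₗ[k] DirectSum ℕ fun n => homogeneous k n :=
  (basis k).constr k fun w => DirectSum.lof k ℕ (fun n => homogeneous k n)
    (w.map ((↑) : ℕ+ → ℕ)).sum ⟨M k w, M_mem_homogeneous w⟩

theorem decomposeAux_M (w : List ℕ+) : decomposeAux (M k w) =
    DirectSum.lof k ℕ (fun n => homogeneous k n)
      (w.map ((↑) : ℕ+ → ℕ)).sum ⟨M k w, M_mem_homogeneous w⟩ := by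
  have h := (basis k).constr_basis k (fun w => DirectSum.lof k ℕ (fun n => homogeneous k n)
    (w.map ((↑) : ℕ+ → ℕ)).sum ⟨M k w, M_mem_homogeneous w⟩) w
  rwa [basis_apply] at h

theorem homogeneous_le_span (n : ℕ) (f : QSym k) (hf : f ∈ homogeneous k n) :
    f ∈ Submodule.span k (M k '' {w | (w.map ((↑) : ℕ+ → ℕ)).sum = n}) := by
  rw [← (basis k).linearCombination_repr f, Finsupp.linearCombination_apply]
  refine Submodule.sum_mem _ fun w hw => Submodule.smul_mem _ _ (Submodule.subset_span ⟨w, ?_, ?_⟩)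
  · rw [Set.mem_ofPred_eq, ← packed_degree]
    exact hf _ (Finsupp.mem_support_iff.1 hw)
  · simp

instance : DirectSum.Decomposition (homogeneous k) :=
    DirectSum.Decomposition.ofLinearMap (homogeneous k) decomposeAux
    (by
      apply (basis k).ext
      intro w
      rw [LinearMap.comp_apply, basis_apply, decomposeAux_M, DirectSum.coeLinearMap_lof]
      rfl)
    (by
      ext n ⟨f, hf⟩ : 2
      simp only [LinearMap.comp_apply, DirectSum.coeLinearMap_lof, LinearMap.id_apply]
      have hf' := homogeneous_le_span n f hf
      induction hf' using Submodule.span_induction with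
      | mem x hx =>
        obtain ⟨w, rfl, rfl⟩ := hx
        exact decomposeAux_M w
      | zero =>
        rw [map_zero]
        exact (map_zero (DirectSum.lof k ℕ (fun n => homogeneous k n) n)).symm
      | add x y hx hy ihx ihy =>
        have hle : Submodule.span k (M k '' {w | (w.map ((↑) : ℕ+ → ℕ)).sum = n}) ≤
            homogeneous k n := by
          rw [Submodule.span_le]
          rintro _ ⟨w, rfl, rfl⟩
          exact M_mem_homogeneous w
        rw [map_add, ihx (hle hx), ihy (hle hy), ← map_add]
        rfl
      | smul r x hx ihx =>
        have hle : Submodule.span k (M k '' {w | (w.map ((↑) : ℕ+ → ℕ)).sum = n}) ≤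
            homogeneous k n := by
          rw [Submodule.span_le]
          rintro _ ⟨w, rfl, rfl⟩
          exact M_mem_homogeneous w
        rw [map_smul, ihx (hle hx), ← map_smul]
        rfl)

/-- `QSym` is graded by degree. -/
instance : GradedAlgebra (homogeneous k) where

theorem finite_support_single (f : QSym k) : (Function.support fun n : ℕ =>
    coeff (Finsupp.single 0 n) (f : MvPowerSeries ℕ k)).Finite := by
  obtain ⟨N, hN⟩ := f.2.1
  refine (Set.finite_Iic N).subset fun n hn => ?_
  simpa using hN _ hn

/-- The algebra map `f ↦ f(X, 0, 0, …)`. -/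
def firstVariable : QSym k →ₐ[k] Polynomial k :=
  AlgHom.ofLinearMap
    { toFun := fun f => Polynomial.ofFinsupp (AddMonoidAlgebra.ofCoeff
        (Finsupp.ofSupportFinite _ (finite_support_single f)))
      map_add' := fun f g => by
        ext n; simp [Polynomial.coeff_ofFinsupp, Finsupp.ofSupportFinite_coe]
      map_smul' := fun r f => by
        ext n; simp [Polynomial.coeff_ofFinsupp, Finsupp.ofSupportFinite_coe] }
    (by
      classical
      ext n
      simp [Polynomial.coeff_ofFinsupp, Finsupp.ofSupportFinite_coe, coeff_one,
        Polynomial.coeff_one])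
    (by
      intro f g
      ext n
      simp [Polynomial.coeff_ofFinsupp, Finsupp.ofSupportFinite_coe, coeff_mul, Polynomial.coeff_mul,
        Finsupp.antidiagonal_single])

theorem coeff_firstVariable (f : QSym k) (n : ℕ) : (firstVariable f).coeff n =
    coeff (Finsupp.single 0 n) (f : MvPowerSeries ℕ k) := rfl

variable (k) in
/-- The canonical character `ζ_Q` of `QSym`: set the first variable to `1` and the other variables
to `0`. -/
def zeta : WithConv (QSym k →ₐ[k] k) :=
  WithConv.toConv ((Polynomial.aeval (1 : k)).comp firstVariable)

end QSym

namespace CombinatorialHopf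

variable {k H : Type*} [CommRing k] [CommRing H]

/-- The canonical involution `h ↦ (-1) ^ n h` (for `h` of degree `n`) of a graded algebra. -/
def involution [Algebra k H] (𝒜 : ℕ → Submodule k H) [GradedAlgebra 𝒜] : H →ₐ[k] H :=
  AlgHom.comp (DirectSum.toAlgebra k (fun n => 𝒜 n) (fun n => (-1 : k) ^ n • (𝒜 n).subtype)
    (by simp)
    (by
      intro i j a b
      simp [pow_add, mul_smul_mul_comm])) (DirectSum.decomposeAlgEquiv 𝒜).toAlgHom

theorem involution_apply [Algebra k H] (𝒜 : ℕ → Submodule k H) [GradedAlgebra 𝒜] (n : ℕ) (h : H)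
    (hh : h ∈ 𝒜 n) : involution 𝒜 h = (-1 : k) ^ n • h := by
  have h1 : DirectSum.decomposeAlgEquiv 𝒜 h = DirectSum.of (fun n => 𝒜 n) n ⟨h, hh⟩ :=
    DirectSum.decompose_of_mem 𝒜 hh
  rw [involution, AlgHom.comp_apply]
  refine (congrArg _ h1).trans ?_
  exact DirectSum.toModule_lof (φ := fun n => (-1 : k) ^ n • (𝒜 n).subtype) k n ⟨h, hh⟩

/-- The involution `φ ↦ φ̄` on characters, `φ̄(h) = (-1) ^ n φ(h)` for `h` of degree `n`. The group
of characters of `H` under convolution is `WithConv (H →ₐ[k] k)`. -/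
def bar [HopfAlgebra k H] (𝒜 : ℕ → Submodule k H) [GradedAlgebra 𝒜]
    (φ : WithConv (H →ₐ[k] k)) : WithConv (H →ₐ[k] k) :=
  WithConv.toConv (φ.ofConv.comp (involution 𝒜))

/-- The canonical odd character `ν = ζ̄⁻¹ ζ` attached to a character `ζ`. -/
def nu [HopfAlgebra k H] (𝒜 : ℕ → Submodule k H) [GradedAlgebra 𝒜]
    (ζ : WithConv (H →ₐ[k] k)) : WithConv (H →ₐ[k] k) :=
  (bar 𝒜 ζ)⁻¹ * ζ

/-- A graded subcoalgebra of `H`: a subspace `C` that is the sum of its intersections with the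
homogeneous components and satisfies `Δ(C) ⊆ C ⊗ C`. -/
structure IsGradedSubcoalgebra [HopfAlgebra k H] (𝒜 : ℕ → Submodule k H) [GradedAlgebra 𝒜]
    (C : Submodule k H) : Prop where
  isHomogeneous : C.IsHomogeneous 𝒜
  comul_mem : ∀ h ∈ C, Coalgebra.comul (R := k) h ∈
    LinearMap.range (TensorProduct.map C.subtype C.subtype)

/-- `S(φ, ψ)`: the largest graded subcoalgebra of `H` on which the characters `φ` and `ψ` agree,
constructed as the sum of all such subcoalgebras. -/
def agreement [HopfAlgebra k H] (𝒜 : ℕ → Submodule k H) [GradedAlgebra 𝒜]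
    (φ ψ : WithConv (H →ₐ[k] k)) : Submodule k H :=
  sSup {C | IsGradedSubcoalgebra 𝒜 C ∧ ∀ h ∈ C, φ.ofConv h = ψ.ofConv h}

theorem isGreatest_agreement [HopfAlgebra k H] (𝒜 : ℕ → Submodule k H) [GradedAlgebra 𝒜]
    (φ ψ : WithConv (H →ₐ[k] k)) :
    IsGreatest {C | IsGradedSubcoalgebra 𝒜 C ∧ ∀ h ∈ C, φ.ofConv h = ψ.ofConv h}
      (agreement 𝒜 φ ψ) := by
  refine ⟨⟨⟨?_, ?_⟩, ?_⟩, fun C hC => le_sSup hC⟩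
  · intro n h hh
    rw [agreement, sSup_eq_iSup'] at hh
    refine Submodule.iSup_induction _ (motive := fun h => (DirectSum.decompose 𝒜 h n : H) ∈ agreement 𝒜 φ ψ)
      hh ?_ ?_ ?_
    · rintro ⟨C, hC⟩ x hx
      exact (le_sSup hC : C ≤ agreement 𝒜 φ ψ) (hC.1.isHomogeneous n hx)
    · simp
    · intro x y hx hy
      rw [DirectSum.decompose_add, DirectSum.add_apply, Submodule.coe_add]
      exact Submodule.add_mem _ hx hy
  · intro h hh
    rw [agreement, sSup_eq_iSup'] at hh
    refine Submodule.iSup_induction _ (motive := fun h => Coalgebra.comul (R := k) h ∈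
      LinearMap.range (TensorProduct.map (agreement 𝒜 φ ψ).subtype (agreement 𝒜 φ ψ).subtype))
      hh ?_ ?_ ?_
    · rintro ⟨C, hC⟩ x hx
      have hle : C ≤ agreement 𝒜 φ ψ := le_sSup hC
      obtain ⟨t, ht⟩ := hC.1.comul_mem x hx
      refine ⟨TensorProduct.map (Submodule.inclusion hle) (Submodule.inclusion hle) t, ?_⟩
      rw [← ht, ← LinearMap.comp_apply, ← TensorProduct.map_comp]
      rfl
    · simp
    · intro x y hx hy
      rw [map_add]
      exact Submodule.add_mem _ hx hy
  · intro h hh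
    rw [agreement, sSup_eq_iSup'] at hh
    refine Submodule.iSup_induction _ (motive := fun h => φ.ofConv h = ψ.ofConv h) hh ?_ ?_ ?_
    · rintro ⟨C, hC⟩ x hx
      exact hC.2 x hx
    · simp
    · intro x y hx hy
      rw [map_add, map_add, hx, hy]

/-- The odd subalgebra `S₋(H, ζ) = S(ζ̄, ζ⁻¹)`. -/
def oddSubalgebra [HopfAlgebra k H] (𝒜 : ℕ → Submodule k H) [GradedAlgebra 𝒜]
    (ζ : WithConv (H →ₐ[k] k)) : Submodule k H :=
  agreement 𝒜 (bar 𝒜 ζ) ζ⁻¹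

end CombinatorialHopf

namespace QSym

variable {k : Type*} [CommRing k]

/-- `Θ` is a morphism of graded Hopf algebras `QSym → QSym` with `ζ_Q ∘ Θ = ν_Q`, where
`ν_Q = ζ̄_Q⁻¹ ζ_Q`. -/
structure IsTheta (Θ : QSym k →ₐc[k] QSym k) : Prop where
  map_homogeneous : ∀ n, ∀ f ∈ homogeneous k n, Θ f ∈ homogeneous k n
  zeta_comp : ∀ f, (zeta k).ofConv (Θ f) =
    (CombinatorialHopf.nu (homogeneous k) (zeta k)).ofConv f

/-- The parts of a composition of `n`, as a list of positive integers. -/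
def parts {n : ℕ} (α : Composition n) : List ℕ+ :=
  α.blocks.pmap (fun a ha => Nat.toPNat a ha) fun _ h => α.blocks_pos h

variable (k) in
/-- `η_β = ∑_{α ≤ β} 2 ^ k(α) M_α`, the sum over the compositions `α` of `n` that are refined by
`β`, that is, whose set of partial sums is contained in that of `β`; `k(α)` is the number of parts
of `α`. -/
def eta {n : ℕ} (β : Composition n) : QSym k :=
  ∑ α : Composition n with α.boundaries ⊆ β.boundaries, (2 : k) ^ α.length • M k (parts α)

/-- The compositions (of all `n ≥ 0`) all of whose parts are odd. -/
abbrev OddComposition : Type := {β : Σ n : ℕ, Composition n // ∀ b ∈ β.2.blocks, Odd b}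

end QSym
end

/-! The argument rests on the universal property of `QSym` as a combinatorial Hopf algebra. Since Δ
is deconcatenation, the coordinate functional of `M_α` is the convolution product of those of
`M_(a)`, for `a` running over the parts of `α`, and the latter are the homogeneous pieces of ζ in
positive degrees. So a degree-preserving coalgebra map Θ into `QSym` is determined by ζ ∘ Θ
(`coalgHom_ext_zeta`). Conversely, a character φ yields f ↦ ∑_v φ_v(f) M_v, where φ_v is the
convolution product of the pieces of φ in degrees v₁, v₂, …; the same rigidity makes this map
multiplicative (`liftLinear_mul`). Taking φ = ν gives Θ.

The image of Θ is a graded subcoalgebra, and both ζ̄ and ζ⁻¹ pull back along Θ to ν⁻¹, so the image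
lies in the odd subalgebra (`range_theta_le_oddSubalgebra`). Moreover ν equals 2 on every
nonconstant `M_w` with odd parts, which gives Θ(M_β) = η_β for odd β (`theta_M_of_odd`). These steps
work over any commutative ring.

If 2 ≠ 0 in a field, the chain span η ⊆ image ⊆ odd subalgebra is closed up as follows. On the odd
subalgebra ζ̄ζ agrees with the counit, which yields generalized Dehn–Sommerville relations between
coordinates (`oddSubalgebra_relation`). They express twice the coordinate at a composition with an
even part through coordinates at longer compositions, so an element is determined by its coordinates
at odd compositions (`eq_zero_of_mem_oddSubalgebra`). At these, the odd η_β form a triangular system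
with invertible diagonal, hence realize all odd coordinates and are independent. -/

noncomputable section

open MvPowerSeries QuasiSymmetric WithConv Coalgebra CombinatorialHopf
open scoped TensorProduct

namespace QSym

section CommRing

variable {k : Type*} [CommRing k]

/-! ### Weights, coordinate functionals and convolution -/

/-- The degree of the monomial quasi-symmetric function `M w`. -/
def weight (w : List ℕ+) : ℕ := (w.map ((↑) : ℕ+ → ℕ)).sum

@[simp] theorem weight_nil : weight [] = 0 := rfl

@[simp] theorem weight_cons (a : ℕ+) (w : List ℕ+) : weight (a :: w) = a + weight w := by
  simp [weight]

@[simp] theorem weight_append (u v : List ℕ+) : weight (u ++ v) = weight u + weight v := by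
  simp [weight]

theorem weight_eq_zero {w : List ℕ+} : weight w = 0 ↔ w = [] := by
  cases w <;> simp

theorem weight_take_add_drop (w : List ℕ+) (i : ℕ) :
    weight (w.take i) + weight (w.drop i) = weight w := by
  rw [← weight_append, List.take_append_drop]

theorem M_mem (w : List ℕ+) : M k w ∈ homogeneous k (weight w) := M_mem_homogeneous w

theorem proj_M (n : ℕ) (w : List ℕ+) :
    GradedAlgebra.proj (homogeneous k) n (M k w) = if weight w = n then M k w else 0 := by
  rw [GradedAlgebra.proj_apply]
  split_ifs with h
  · subst h
    exact DirectSum.decompose_of_mem_same _ (M_mem w)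
  · exact DirectSum.decompose_of_mem_ne _ (M_mem w) h

theorem proj_of_mem {n m : ℕ} {f : QSym k} (hf : f ∈ homogeneous k m) :
    GradedAlgebra.proj (homogeneous k) n f = if m = n then f else 0 := by
  rw [GradedAlgebra.proj_apply]
  split_ifs with h
  · subst h
    exact DirectSum.decompose_of_mem_same _ hf
  · exact DirectSum.decompose_of_mem_ne _ hf h

theorem convMul_M (φ ψ : WithConv (QSym k →ₗ[k] k)) (w : List ℕ+) :
    (φ * ψ) (M k w) =
      ∑ i ∈ Finset.range (w.length + 1), φ (M k (w.take i)) * ψ (M k (w.drop i)) := by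
  rw [LinearMap.convMul_apply, comul_M]
  simp only [map_sum, TensorProduct.map_tmul, LinearMap.mul'_apply]

theorem functional_ext {V : Type*} [AddCommMonoid V] [Module k V]
    {φ ψ : WithConv (QSym k →ₗ[k] V)} (h : ∀ w, φ (M k w) = ψ (M k w)) : φ = ψ := by
  apply WithConv.ofConv_injective
  apply (basis k).ext
  intro w
  rw [basis_apply]
  exact h w

/-- The coordinate functionals of the monomial basis, in the convolution algebra. -/
def coord (w : List ℕ+) : WithConv (QSym k →ₗ[k] k) := toConv ((basis k).coord w)

theorem coord_M (w v : List ℕ+) : coord w (M k v) = if v = w then 1 else 0 :=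
  coeff_packed_M v w |>.trans (by simp [eq_comm])

theorem ext_coord {f g : QSym k} (h : ∀ w, coord w f = coord w g) : f = g := ext_packed h

/-- Dual to the deconcatenation coproduct: convolution concatenates words. Every coordinate
functional is thus a product of the `coord [a]`. -/
theorem coord_append (u v : List ℕ+) : (coord (u ++ v) : WithConv (QSym k →ₗ[k] k)) =
    coord u * coord v := by
  apply functional_ext
  intro w
  have h : (if w = u ++ v then (1 : k) else 0) = if u ++ v = w then 1 else 0 := by
    simp only [eq_comm]
  rw [convMul_M, coord_M, h, ← sum_deconcatenations]
  apply Finset.sum_congr rfl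
  intro i _
  rw [coord_M, coord_M, ite_and, ite_mul, one_mul, zero_mul]
  simp only [eq_comm]

theorem coord_nil : (coord [] : WithConv (QSym k →ₗ[k] k)) = 1 := by
  apply functional_ext
  intro w
  rw [coord_M, LinearMap.convOne_apply, counit_M]
  simp

theorem coord_cons (a : ℕ+) (v : List ℕ+) : (coord (a :: v) : WithConv (QSym k →ₗ[k] k)) =
    coord [a] * coord v := coord_append [a] v

theorem convMul_coalgHom_apply {C D : Type*} [AddCommMonoid C] [Module k C] [Coalgebra k C]
    [AddCommMonoid D] [Module k D] [Coalgebra k D]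
    (φ ψ : WithConv (D →ₗ[k] k)) (f : C →ₗc[k] D) (c : C) :
    (φ * ψ) (f c) = (toConv (φ.ofConv ∘ₗ f.toLinearMap) * toConv (ψ.ofConv ∘ₗ f.toLinearMap)) c :=
  LinearMap.congr_fun (LinearMap.convMul_comp_coalgHom_distrib φ ψ f) c

/-- A coalgebra map to `QSym` is determined by its composites with the coordinate functionals of
the `M_(a)`. -/
theorem coalgHom_ext {C : Type*} [AddCommMonoid C] [Module k C] [Coalgebra k C]
    {f g : C →ₗc[k] QSym k} (h : ∀ (a : ℕ+) (c : C), coord [a] (f c) = coord [a] (g c)) :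
    f = g := by
  have key : ∀ (w : List ℕ+) (c : C), coord w (f c) = coord w (g c) := by
    intro w
    induction w with
    | nil =>
      intro c
      -- The coordinate at the empty word is the counit, which every coalgebra map preserves.
      rw [coord_nil, LinearMap.convOne_apply, LinearMap.convOne_apply,
        CoalgHomClass.counit_comp_apply, CoalgHomClass.counit_comp_apply]
    | cons a w ih =>
      intro c
      rw [coord_cons, convMul_coalgHom_apply, convMul_coalgHom_apply]
      have h1 : (coord [a]).ofConv ∘ₗ f.toLinearMap = (coord [a]).ofConv ∘ₗ g.toLinearMap :=
        LinearMap.ext (h a)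
      have h2 : (coord w).ofConv ∘ₗ f.toLinearMap = (coord w).ofConv ∘ₗ g.toLinearMap :=
        LinearMap.ext ih
      rw [h1, h2]
  ext1 c
  exact ext_coord fun w => key w c

/-! ### The coalgebra endomorphism attached to a functional -/

/-- The restriction of a functional to the component of degree `n`, extended by zero. -/
def atDegree (φ : WithConv (QSym k →ₗ[k] k)) (n : ℕ) : WithConv (QSym k →ₗ[k] k) :=
  toConv (φ.ofConv ∘ₗ GradedAlgebra.proj (homogeneous k) n)

theorem atDegree_apply (φ : WithConv (QSym k →ₗ[k] k)) (n : ℕ) (f : QSym k) :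
    atDegree φ n f = φ (GradedAlgebra.proj (homogeneous k) n f) := rfl

theorem atDegree_M (φ : WithConv (QSym k →ₗ[k] k)) (n : ℕ) (w : List ℕ+) :
    atDegree φ n (M k w) = if weight w = n then φ (M k w) else 0 := by
  rw [atDegree_apply, proj_M]
  split_ifs <;> simp

/-- The convolution product of the restrictions of `φ` to the degrees `a₁, …, aₘ`. -/
def multiDegree (φ : WithConv (QSym k →ₗ[k] k)) (v : List ℕ+) : WithConv (QSym k →ₗ[k] k) :=
  (v.map fun a => atDegree φ a).prod

theorem multiDegree_nil (φ : WithConv (QSym k →ₗ[k] k)) : multiDegree φ [] = 1 := rfl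

theorem multiDegree_cons (φ : WithConv (QSym k →ₗ[k] k)) (a : ℕ+) (v : List ℕ+) :
    multiDegree φ (a :: v) = atDegree φ a * multiDegree φ v := by
  simp [multiDegree]

theorem multiDegree_singleton (φ : WithConv (QSym k →ₗ[k] k)) (a : ℕ+) :
    multiDegree φ [a] = atDegree φ a := by
  simp [multiDegree]

theorem multiDegree_append (φ : WithConv (QSym k →ₗ[k] k)) (u v : List ℕ+) :
    multiDegree φ (u ++ v) = multiDegree φ u * multiDegree φ v := by
  simp [multiDegree]

theorem multiDegree_nil_M (φ : WithConv (QSym k →ₗ[k] k)) (w : List ℕ+) :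
    multiDegree φ [] (M k w) = if w = [] then 1 else 0 := by
  rw [multiDegree_nil, LinearMap.convOne_apply, counit_M]
  simp

/-- The value at `M w` sums over cuts of `w` into blocks whose weights are the parts of `v`, and
such a cut forces equal weights. Hence the finite range of summation in `liftLinear` loses no term.
-/
theorem multiDegree_M_of_weight_ne (φ : WithConv (QSym k →ₗ[k] k)) {v w : List ℕ+}
    (h : weight v ≠ weight w) : multiDegree φ v (M k w) = 0 := by
  induction v generalizing w with
  | nil =>
    rw [multiDegree_nil_M, if_neg]
    rintro rfl
    exact h rfl
  | cons a v ih =>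
    rw [multiDegree_cons, convMul_M]
    refine Finset.sum_eq_zero fun i _ => ?_
    rw [atDegree_M]
    split_ifs with ha
    · rw [ih, mul_zero]
      intro hv
      rw [weight_cons, ← ha, hv, weight_take_add_drop] at h
      exact h rfl
    · rw [zero_mul]

/-- The linear map `f ↦ ∑_v φ_v(f) M_v`, where `φ_v` is `multiDegree φ v`. -/
def liftLinear (φ : WithConv (QSym k →ₗ[k] k)) : QSym k →ₗ[k] QSym k :=
  (basis k).constr k fun w =>
    ∑ v ∈ (finite_sum_le (weight w)).toFinset, multiDegree φ v (M k w) • M k v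

theorem liftLinear_M (φ : WithConv (QSym k →ₗ[k] k)) (w : List ℕ+) :
    liftLinear φ (M k w) =
      ∑ v ∈ (finite_sum_le (weight w)).toFinset, multiDegree φ v (M k w) • M k v := by
  rw [← basis_apply]
  exact ((basis k).constr_basis k _ w).trans (by simp)

theorem coord_liftLinear (φ : WithConv (QSym k →ₗ[k] k)) (v : List ℕ+) (f : QSym k) :
    coord v (liftLinear φ f) = multiDegree φ v f := by
  suffices h : (toConv ((coord v).ofConv ∘ₗ liftLinear φ) : WithConv (QSym k →ₗ[k] k)) =
      multiDegree φ v from congrArg (fun ψ : WithConv (QSym k →ₗ[k] k) => ψ f) h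
  apply functional_ext
  intro w
  change coord v (liftLinear φ (M k w)) = _
  rw [liftLinear_M, map_sum]
  simp only [map_smul, coord_M, smul_eq_mul, mul_ite, mul_one, mul_zero]
  rw [Finset.sum_ite_eq']
  split_ifs with h
  · rfl
  · rw [multiDegree_M_of_weight_ne]
    intro hvw
    apply h
    rw [Set.Finite.mem_toFinset]
    exact hvw.le

theorem liftLinear_M_mem (φ : WithConv (QSym k →ₗ[k] k)) (w : List ℕ+) :
    liftLinear φ (M k w) ∈ homogeneous k (weight w) := by
  rw [liftLinear_M]
  refine Submodule.sum_mem _ fun v _ => ?_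
  by_cases h : weight v = weight w
  · rw [← h]
    exact Submodule.smul_mem _ _ (M_mem v)
  · rw [multiDegree_M_of_weight_ne φ h, zero_smul]
    exact Submodule.zero_mem _

theorem map_mem_homogeneous {f : QSym k →ₗ[k] QSym k}
    (hf : ∀ w, f (M k w) ∈ homogeneous k (weight w)) (n : ℕ) (x : QSym k)
    (hx : x ∈ homogeneous k n) : f x ∈ homogeneous k n := by
  have h : Submodule.span k (M k '' {w | (w.map ((↑) : ℕ+ → ℕ)).sum = n}) ≤
      (homogeneous k n).comap f := by
    rw [Submodule.span_le]
    rintro _ ⟨w, rfl, rfl⟩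
    exact hf w
  exact h (homogeneous_le_span n x hx)

/-- On an element Δ(f) the tested quantity is the convolution `coord u * coord v` at `f`, so
compatibility with Δ becomes an identity of coordinates. -/
theorem tensor_ext {s t : QSym k ⊗[k] QSym k}
    (h : ∀ u v, LinearMap.mul' k k (TensorProduct.map (coord u).ofConv (coord v).ofConv s) =
      LinearMap.mul' k k (TensorProduct.map (coord u).ofConv (coord v).ofConv t)) : s = t := by
  have key : ∀ (u v : List ℕ+) (t : QSym k ⊗[k] QSym k),
      ((basis k).tensorProduct (basis k)).repr t (u, v) =
        LinearMap.mul' k k (TensorProduct.map (coord u).ofConv (coord v).ofConv t) := by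
    intro u v t
    induction t with
    | zero => simp
    | add a b ha hb => simp only [map_add, Finsupp.add_apply, ha, hb]
    | tmul f g =>
      rw [Module.Basis.tensorProduct_repr_tmul_apply, TensorProduct.map_tmul,
        LinearMap.mul'_apply, smul_eq_mul, mul_comm]
      rfl
  apply ((basis k).tensorProduct (basis k)).repr.injective
  ext ⟨u, v⟩
  rw [key, key, h]

/-- The coalgebra endomorphism of `QSym` attached to a functional. -/
def liftCoalgHom (φ : WithConv (QSym k →ₗ[k] k)) : QSym k →ₗc[k] QSym k where
  __ := liftLinear φ
  counit_comp := by
    ext f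
    have h := coord_liftLinear φ [] f
    rw [coord_nil, multiDegree_nil] at h
    exact h
  map_comp_comul := by
    ext f
    -- Both sides become `multiDegree φ (u ++ v) f`, as `coord` and `multiDegree φ` both turn
    -- concatenation into convolution.
    refine tensor_ext fun u v => ?_
    have h1 : (coord u).ofConv ∘ₗ liftLinear φ = (multiDegree φ u).ofConv :=
      LinearMap.ext (coord_liftLinear φ u)
    have h2 : (coord v).ofConv ∘ₗ liftLinear φ = (multiDegree φ v).ofConv :=
      LinearMap.ext (coord_liftLinear φ v)
    have h3 := coord_liftLinear φ (u ++ v) f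
    rw [coord_append, multiDegree_append, LinearMap.convMul_apply, LinearMap.convMul_apply] at h3
    refine Eq.trans ?_ h3.symm
    rw [← h1, ← h2, TensorProduct.map_comp]
    rfl

/-! ### The character ζ and the universal property -/

theorem firstVariable_M (w : List ℕ+) : firstVariable (M k w) =
    if w.length ≤ 1 then Polynomial.X ^ weight w else 0 := by
  have h : ∀ n : ℕ, exponents (Finsupp.single 0 n) = w.map ((↑) : ℕ+ → ℕ) ↔
      w.length ≤ 1 ∧ n = weight w := by
    intro n
    by_cases hn : n = 0
    · subst hn
      cases w with
      | nil => simp [exponents]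
      | cons a w => simp [exponents, (add_pos_of_pos_of_nonneg a.pos (zero_le : 0 ≤ weight w)).ne]
    · have he : exponents (Finsupp.single 0 n) = [n] := by
        simp [exponents, Finsupp.support_single, hn]
      rw [he]
      match w with
      | [] => simpa using hn
      | [a] => simp
      | a :: b :: w => simp
  ext n
  rw [coeff_firstVariable, coeff_M]
  simp only [h]
  split_ifs <;> simp_all [Polynomial.coeff_X_pow]

theorem zeta_M (w : List ℕ+) : (zeta k).ofConv (M k w) = if w.length ≤ 1 then 1 else 0 := by
  change Polynomial.aeval (1 : k) (firstVariable (M k w)) = _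
  rw [firstVariable_M]
  split_ifs <;> simp

/-- The linear functional underlying a character. -/
def toFunctional (φ : WithConv (QSym k →ₐ[k] k)) : WithConv (QSym k →ₗ[k] k) :=
  toConv φ.ofConv.toLinearMap

theorem toFunctional_apply (φ : WithConv (QSym k →ₐ[k] k)) (f : QSym k) :
    toFunctional φ f = φ.ofConv f := rfl

theorem toFunctional_mul (φ ψ : WithConv (QSym k →ₐ[k] k)) :
    toFunctional (φ * ψ) = toFunctional φ * toFunctional ψ := rfl

theorem toFunctional_one : toFunctional (1 : WithConv (QSym k →ₐ[k] k)) = 1 := rfl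

theorem character_ext {φ ψ : WithConv (QSym k →ₐ[k] k)}
    (h : ∀ w, φ.ofConv (M k w) = ψ.ofConv (M k w)) : φ = ψ := by
  apply WithConv.ofConv_injective
  apply AlgHom.toLinearMap_injective
  exact congrArg WithConv.ofConv (functional_ext (φ := toFunctional φ) (ψ := toFunctional ψ) h)

/-- ζ vanishes on compositions with two or more parts, and for `a > 0` the only composition of `a`
with at most one part is `(a)`. This is what ties ζ to the coordinate functionals. -/
theorem atDegree_zeta (a : ℕ+) : atDegree (toFunctional (zeta k)) a = coord [a] := by
  apply functional_ext
  intro w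
  rw [atDegree_M, coord_M, toFunctional_apply, zeta_M]
  match w with
  | [] => simp [a.pos.ne]
  | [b] => simp
  | b :: c :: w => simp

/-- A homogeneous coalgebra endomorphism `f` of `QSym` is determined by `ζ ∘ f`. -/
theorem coalgHom_ext_zeta {f g : QSym k →ₗc[k] QSym k}
    (hf : ∀ n, ∀ x ∈ homogeneous k n, f x ∈ homogeneous k n)
    (hg : ∀ n, ∀ x ∈ homogeneous k n, g x ∈ homogeneous k n)
    (h : ∀ x, (zeta k).ofConv (f x) = (zeta k).ofConv (g x)) : f = g := by
  have key : ∀ f : QSym k →ₗc[k] QSym k,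
      (∀ n, ∀ x ∈ homogeneous k n, f x ∈ homogeneous k n) → ∀ (a : ℕ+) (w : List ℕ+),
      coord [a] (f (M k w)) = if weight w = a then (zeta k).ofConv (f (M k w)) else 0 := by
    intro f hf a w
    -- Homogeneity enters here: the image of `M w` has a single component, so the coordinate at
    -- `(a)` is either ζ of the whole image or zero.
    rw [← atDegree_zeta, atDegree_apply, proj_of_mem (hf _ _ (M_mem w))]
    split_ifs
    · rfl
    · exact map_zero _
  apply coalgHom_ext
  intro a c
  suffices h1 : (coord [a]).ofConv ∘ₗ f.toLinearMap = (coord [a]).ofConv ∘ₗ g.toLinearMap from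
    LinearMap.congr_fun h1 c
  apply (basis k).ext
  intro w
  rw [basis_apply]
  change coord [a] (f (M k w)) = coord [a] (g (M k w))
  rw [key f hf, key g hg, h]

theorem liftLinear_one (φ : WithConv (QSym k →ₐ[k] k)) : liftLinear (toFunctional φ) 1 = 1 := by
  rw [← M_nil]
  apply ext_coord
  intro v
  rw [coord_liftLinear, coord_M]
  split_ifs with h
  · rw [← h, multiDegree_nil_M, if_pos rfl]
  · apply multiDegree_M_of_weight_ne
    rw [weight_nil, ne_eq, weight_eq_zero]
    exact fun h' => h h'.symm

theorem zeta_liftLinear (φ : WithConv (QSym k →ₐ[k] k)) (f : QSym k) :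
    (zeta k).ofConv (liftLinear (toFunctional φ) f) = φ.ofConv f := by
  suffices h : (toConv ((zeta k).ofConv.toLinearMap ∘ₗ liftLinear (toFunctional φ)) :
      WithConv (QSym k →ₗ[k] k)) = toFunctional φ from
    congrArg (fun ψ : WithConv (QSym k →ₗ[k] k) => ψ f) h
  apply functional_ext
  intro w
  change (zeta k).ofConv (liftLinear (toFunctional φ) (M k w)) = φ.ofConv (M k w)
  -- Degree 0 is separate, since no part has size 0; there φ(1) = 1 is needed. In positive degree, ζ
  -- of a homogeneous element is its coordinate at the one-part composition.
  rcases Nat.eq_zero_or_pos (weight w) with hw | hw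
  · rw [weight_eq_zero] at hw
    subst hw
    rw [M_nil, liftLinear_one, map_one, map_one]
  · have h1 := proj_of_mem (n := weight w) (liftLinear_M_mem (toFunctional φ) w)
    rw [if_pos rfl] at h1
    obtain ⟨a, ha⟩ : ∃ a : ℕ+, (a : ℕ) = weight w := ⟨⟨weight w, hw⟩, rfl⟩
    have h2 := coord_liftLinear (toFunctional φ) [a] (M k w)
    rw [multiDegree_singleton, atDegree_M, if_pos ha.symm, ← atDegree_zeta,
      atDegree_apply, ha] at h2
    refine Eq.trans ?_ h2
    exact congrArg (zeta k).ofConv h1.symm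

/-- The product of `QSym` is a coalgebra map, so `f ⊗ g ↦ Θ(fg)` and `f ⊗ g ↦ Θ(f)Θ(g)` are both
coalgebra maps into `QSym`. By `coalgHom_ext` only coordinates at one-part compositions matter;
these are values of ζ, and the claim reduces to φ being multiplicative. -/
theorem liftLinear_mul (φ : WithConv (QSym k →ₐ[k] k)) (f g : QSym k) :
    liftLinear (toFunctional φ) (f * g) =
      liftLinear (toFunctional φ) f * liftLinear (toFunctional φ) g := by
  let Θ := liftCoalgHom (toFunctional φ)
  suffices h : Θ.comp (Bialgebra.mulCoalgHom k (QSym k)) =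
      (Bialgebra.mulCoalgHom k (QSym k)).comp (Coalgebra.TensorProduct.map Θ Θ) from
    DFunLike.congr_fun h (f ⊗ₜ g)
  apply coalgHom_ext
  intro a c
  suffices h : (coord [a]).ofConv ∘ₗ liftLinear (toFunctional φ) ∘ₗ LinearMap.mul' k (QSym k) =
      (coord [a]).ofConv ∘ₗ LinearMap.mul' k (QSym k) ∘ₗ
        TensorProduct.map (liftLinear (toFunctional φ)) (liftLinear (toFunctional φ)) from
    LinearMap.congr_fun h c
  apply ((basis k).tensorProduct (basis k)).ext
  rintro ⟨u, v⟩
  simp only [Module.Basis.tensorProduct_apply, basis_apply, LinearMap.comp_apply,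
    LinearMap.mul'_apply, TensorProduct.map_tmul]
  refine (coord_liftLinear _ _ _).trans ?_
  rw [← atDegree_zeta, multiDegree_singleton, atDegree_apply]
  refine Eq.trans ?_ (atDegree_apply _ _ _).symm
  rw [proj_of_mem (SetLike.mul_mem_graded (M_mem u) (M_mem v)),
    proj_of_mem (SetLike.mul_mem_graded (liftLinear_M_mem (toFunctional φ) u)
      (liftLinear_M_mem (toFunctional φ) v))]
  split_ifs
  · rw [toFunctional_apply, toFunctional_apply, map_mul, map_mul, zeta_liftLinear, zeta_liftLinear]
  · rw [map_zero, map_zero]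

/-- The morphism of graded Hopf algebras `QSym → QSym` attached to a character. -/
def liftBialgHom (φ : WithConv (QSym k →ₐ[k] k)) : QSym k →ₐc[k] QSym k where
  __ := liftCoalgHom (toFunctional φ)
  map_one' := liftLinear_one φ
  map_mul' := liftLinear_mul φ

theorem liftBialgHom_apply (φ : WithConv (QSym k →ₐ[k] k)) (f : QSym k) :
    liftBialgHom φ f = liftLinear (toFunctional φ) f := rfl

theorem isTheta_liftBialgHom :
    IsTheta (liftBialgHom (CombinatorialHopf.nu (homogeneous k) (zeta k))) where
  map_homogeneous := map_mem_homogeneous (liftLinear_M_mem _)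
  zeta_comp := zeta_liftLinear _

theorem IsTheta.unique {Θ Θ' : QSym k →ₐc[k] QSym k} (h : IsTheta Θ) (h' : IsTheta Θ') :
    Θ = Θ' := by
  have h1 : (Θ : QSym k →ₗc[k] QSym k) = Θ' :=
    coalgHom_ext_zeta h.map_homogeneous h'.map_homogeneous fun x =>
      (h.zeta_comp x).trans (h'.zeta_comp x).symm
  exact DFunLike.ext _ _ fun x => DFunLike.congr_fun h1 x

/-! ### Oddness of ν and the image of Θ -/

theorem bar_M (φ : WithConv (QSym k →ₐ[k] k)) (w : List ℕ+) :
    (bar (homogeneous k) φ).ofConv (M k w) = (-1) ^ weight w * φ.ofConv (M k w) := by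
  change φ.ofConv (involution (homogeneous k) (M k w)) = _
  rw [involution_apply (homogeneous k) (weight w) (M k w) (M_mem w)]
  exact φ.ofConv.toLinearMap.map_smul _ _

theorem bar_mul (φ ψ : WithConv (QSym k →ₐ[k] k)) :
    bar (homogeneous k) (φ * ψ) = bar (homogeneous k) φ * bar (homogeneous k) ψ := by
  apply character_ext
  intro w
  rw [bar_M, ← toFunctional_apply, ← toFunctional_apply, toFunctional_mul, toFunctional_mul,
    convMul_M, convMul_M, Finset.mul_sum]
  refine Finset.sum_congr rfl fun i _ => ?_
  rw [toFunctional_apply, toFunctional_apply, toFunctional_apply, toFunctional_apply, bar_M, bar_M,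
    ← weight_take_add_drop w i, pow_add]
  ring

theorem bar_bar (φ : WithConv (QSym k →ₐ[k] k)) :
    bar (homogeneous k) (bar (homogeneous k) φ) = φ := by
  apply character_ext
  intro w
  rw [bar_M, bar_M, ← mul_assoc, ← mul_pow]
  simp

theorem bar_inv (φ : WithConv (QSym k →ₐ[k] k)) :
    bar (homogeneous k) φ⁻¹ = (bar (homogeneous k) φ)⁻¹ :=
  map_inv (MonoidHom.mk' (bar (homogeneous k)) bar_mul) φ

/-- The bar is an involutive endomorphism of the character group, so it sends ζ̄⁻¹ζ to ζ⁻¹ζ̄. -/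
theorem bar_nu (ζ : WithConv (QSym k →ₐ[k] k)) :
    bar (homogeneous k) (nu (homogeneous k) ζ) = (nu (homogeneous k) ζ)⁻¹ := by
  rw [nu, bar_mul, bar_inv, bar_bar, mul_inv_rev, inv_inv]

/-- Since Θ preserves degrees it commutes with the sign involution, so pulling ζ̄ back along Θ gives
ν̄ = ν⁻¹. -/
theorem bar_zeta_comp_theta {Θ : QSym k →ₐc[k] QSym k} (h : IsTheta Θ) (f : QSym k) :
    (bar (homogeneous k) (zeta k)).ofConv (Θ f) =
      (nu (homogeneous k) (zeta k))⁻¹.ofConv f := by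
  rw [← bar_nu]
  suffices h1 : toConv ((bar (homogeneous k) (zeta k)).ofConv.comp (Θ : QSym k →ₐ[k] QSym k)) =
      bar (homogeneous k) (nu (homogeneous k) (zeta k)) from
    congrArg (fun φ : WithConv (QSym k →ₐ[k] k) => φ.ofConv f) h1
  apply character_ext
  intro w
  rw [bar_M, ← h.zeta_comp]
  change (zeta k).ofConv (involution (homogeneous k) (Θ (M k w))) = _
  rw [involution_apply _ _ _ (h.map_homogeneous _ _ (M_mem w))]
  exact (zeta k).ofConv.toLinearMap.map_smul _ _

/-- Precomposition with a bialgebra map respects convolution and the counit, hence inverses. -/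
theorem inv_comp_bialgHom (φ : WithConv (QSym k →ₐ[k] k)) (Θ : QSym k →ₐc[k] QSym k) :
    toConv (φ⁻¹.ofConv.comp (Θ : QSym k →ₐ[k] QSym k)) =
      (toConv (φ.ofConv.comp (Θ : QSym k →ₐ[k] QSym k)))⁻¹ := by
  apply eq_inv_of_mul_eq_one_left
  apply WithConv.ofConv_injective
  rw [← AlgHom.convMul_comp_bialgHom_distrib, inv_mul_cancel]
  ext f
  exact CoalgHomClass.counit_comp_apply (R := k) Θ f

theorem zeta_inv_comp_theta {Θ : QSym k →ₐc[k] QSym k} (h : IsTheta Θ) (f : QSym k) :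
    (zeta k)⁻¹.ofConv (Θ f) = (nu (homogeneous k) (zeta k))⁻¹.ofConv f := by
  have h1 : toConv ((zeta k).ofConv.comp (Θ : QSym k →ₐ[k] QSym k)) =
      nu (homogeneous k) (zeta k) := by
    apply WithConv.ofConv_injective
    ext f
    exact h.zeta_comp f
  have h2 := inv_comp_bialgHom (zeta k) Θ
  rw [h1] at h2
  exact congrArg (fun φ : WithConv (QSym k →ₐ[k] k) => φ.ofConv f) h2

theorem range_theta_le_oddSubalgebra {Θ : QSym k →ₐc[k] QSym k} (h : IsTheta Θ) :
    LinearMap.range (Θ : QSym k →ₗ[k] QSym k) ≤ oddSubalgebra (homogeneous k) (zeta k) := by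
  refine le_sSup ⟨⟨?_, ?_⟩, ?_⟩
  · rintro n _ ⟨f, rfl⟩
    refine ⟨DirectSum.decompose (homogeneous k) f n, ?_⟩
    suffices h1 : (Θ : QSym k →ₗ[k] QSym k) ∘ₗ GradedAlgebra.proj (homogeneous k) n =
        GradedAlgebra.proj (homogeneous k) n ∘ₗ (Θ : QSym k →ₗ[k] QSym k) from
      LinearMap.congr_fun h1 f
    apply (basis k).ext
    intro w
    rw [basis_apply]
    change Θ (GradedAlgebra.proj (homogeneous k) n (M k w)) =
      GradedAlgebra.proj (homogeneous k) n (Θ (M k w))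
    rw [proj_M, proj_of_mem (h.map_homogeneous _ _ (M_mem w))]
    split_ifs
    · rfl
    · exact map_zero Θ
  · rintro _ ⟨f, rfl⟩
    refine ⟨TensorProduct.map (Θ : QSym k →ₗ[k] QSym k).rangeRestrict
      (Θ : QSym k →ₗ[k] QSym k).rangeRestrict (comul f), ?_⟩
    rw [← LinearMap.comp_apply, ← TensorProduct.map_comp]
    exact CoalgHomClass.map_comp_comul_apply Θ f
  · rintro _ ⟨f, rfl⟩
    exact (bar_zeta_comp_theta h f).trans (zeta_inv_comp_theta h f).symm

/-! ### Values of ν on odd compositions -/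

/-- This is ζ̄ν = ζ evaluated at `M (a :: w)`: ζ̄ kills left factors with at least two parts, so
only the cuts before and after `a` contribute. -/
theorem nu_M_cons (a : ℕ+) (w : List ℕ+) : (nu (homogeneous k) (zeta k)).ofConv (M k (a :: w)) +
    (-1) ^ (a : ℕ) * (nu (homogeneous k) (zeta k)).ofConv (M k w) =
      if w = [] then 1 else 0 := by
  have h1 : bar (homogeneous k) (zeta k) * nu (homogeneous k) (zeta k) = zeta k := by
    rw [nu, mul_inv_cancel_left]
  have h2 := congrArg (fun φ => toFunctional φ (M k (a :: w))) h1
  simp only [toFunctional_mul] at h2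
  rw [convMul_M, List.length_cons, Finset.sum_range_succ', Finset.sum_range_succ',
    Finset.sum_eq_zero] at h2
  · simp only [toFunctional_apply, bar_M, zeta_M] at h2
    simp only [List.take_zero, List.drop_zero, zero_add, List.take_succ_cons, List.drop_succ_cons,
      List.length_cons, List.length_nil] at h2
    rw [add_comm]
    simpa using h2
  · intro i hi
    rw [toFunctional_apply, bar_M, zeta_M, if_neg, mul_zero, zero_mul]
    rw [Finset.mem_range] at hi
    rw [List.length_take, List.length_cons]
    omega

/-- On monomial quasi-symmetric functions with odd parts, the canonical odd character is `2`. -/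
theorem nu_M_of_odd {w : List ℕ+} (hw : ∀ a ∈ w, Odd (a : ℕ)) (h0 : w ≠ []) :
    (nu (homogeneous k) (zeta k)).ofConv (M k w) = 2 := by
  induction w with
  | nil => exact absurd rfl h0
  | cons a w ih =>
    have h := nu_M_cons (k := k) a w
    rw [(hw a List.mem_cons_self).neg_one_pow] at h
    by_cases hn : w = []
    · subst hn
      -- For odd `a` the recursion reads ν(M_(a)) = 1 + ν(1) = 2, and otherwise ν(M_(a,w)) = ν(M_w).
      rw [M_nil, map_one, if_pos rfl] at h
      linear_combination h
    · rw [ih (fun b hb => hw b (List.mem_cons_of_mem _ hb)) hn, if_neg hn] at h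
      linear_combination h

/-! ### The refinement order and the identity Θ(M_β) = η_β -/

/-- `v ≤ w`: the composition `w` refines the composition `v`, that is, they have the same weight
and the partial sums of `v` are among those of `w`. -/
def Coarser (v w : List ℕ+) : Prop :=
  weight v = weight w ∧ ∀ i, ∃ j, weight (w.take j) = weight (v.take i)

theorem weight_take_lt {w : List ℕ+} {i j : ℕ} (hij : i < j) (hj : j ≤ w.length) :
    weight (w.take i) < weight (w.take j) := by
  obtain ⟨m, rfl⟩ := Nat.exists_eq_add_of_lt hij
  rw [add_assoc, List.take_add, weight_append]
  have : weight ((w.drop i).take (m + 1)) ≠ 0 := by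
    rw [ne_eq, weight_eq_zero, List.take_eq_nil_iff, List.drop_eq_nil_iff]
    omega
  omega

theorem coarser_nil {w : List ℕ+} : Coarser [] w ↔ w = [] := by
  constructor
  · intro h
    exact weight_eq_zero.1 h.1.symm
  · rintro rfl
    exact ⟨rfl, fun i => ⟨0, by simp⟩⟩

/-- This puts refinement in the recursive form of `multiDegree_cons`: one initial block of `w` is
merged into `a`, and the rest of `w` refines `v`. -/
theorem coarser_cons {a : ℕ+} {v w : List ℕ+} : Coarser (a :: v) w ↔
    ∃ i ≤ w.length, weight (w.take i) = a ∧ Coarser v (w.drop i) := by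
  constructor
  · rintro ⟨hw, h⟩
    obtain ⟨i, hi, hia⟩ : ∃ i ≤ w.length, weight (w.take i) = a := by
      obtain ⟨j, hj⟩ := h 1
      rcases le_total j w.length with hjw | hjw
      · exact ⟨j, hjw, by simpa using hj⟩
      -- `take` saturates beyond the end of the list, so the index can be lowered to `w.length`.
      · exact ⟨w.length, le_rfl, by simpa [List.take_of_length_le hjw] using hj⟩
    refine ⟨i, hi, hia, ?_, fun m => ?_⟩
    · have := weight_take_add_drop w i
      rw [weight_cons] at hw
      omega
    · obtain ⟨j, hj⟩ := h (m + 1)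
      rw [List.take_succ_cons, weight_cons] at hj
      rcases lt_or_ge j i with hji | hji
      · have := weight_take_lt hji hi
        omega
      · obtain ⟨l, rfl⟩ := Nat.exists_eq_add_of_le hji
        rw [List.take_add, weight_append] at hj
        exact ⟨l, by omega⟩
  · rintro ⟨i, -, hia, hw, h⟩
    refine ⟨?_, fun m => ?_⟩
    · have := weight_take_add_drop w i
      rw [weight_cons]
      omega
    · cases m with
      | zero => exact ⟨0, by simp⟩
      | succ m =>
        obtain ⟨l, hl⟩ := h m
        refine ⟨i + l, ?_⟩
        rw [List.take_add, weight_append, List.take_succ_cons, weight_cons]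
        omega

open Classical in
-- Partial sums increase strictly, so at most one cut of `w` has block weights equal to the parts of
-- `v`; each of its blocks is nonempty with odd parts and contributes a factor 2.
theorem multiDegree_M_of_odd {φ : WithConv (QSym k →ₗ[k] k)}
    (hφ : ∀ w : List ℕ+, (∀ a ∈ w, Odd (a : ℕ)) → w ≠ [] → φ (M k w) = 2)
    (v w : List ℕ+) (hw : ∀ a ∈ w, Odd (a : ℕ)) :
    multiDegree φ v (M k w) = if Coarser v w then 2 ^ v.length else 0 := by
  induction v generalizing w with
  | nil => simp [multiDegree_nil_M, coarser_nil]
  | cons a v ih =>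
    rw [multiDegree_cons, convMul_M]
    have hdrop : ∀ i, ∀ b ∈ w.drop i, Odd (b : ℕ) := fun i b hb => hw b (List.mem_of_mem_drop hb)
    have htake : ∀ i, ∀ b ∈ w.take i, Odd (b : ℕ) := fun i b hb => hw b (List.mem_of_mem_take hb)
    split_ifs with h
    · obtain ⟨i, hi, hia, hv⟩ := coarser_cons.1 h
      rw [Finset.sum_eq_single i]
      · rw [atDegree_M, if_pos hia, ih _ (hdrop i), if_pos hv, hφ _ (htake i), List.length_cons,
          pow_succ']
        intro h0
        rw [h0] at hia
        exact a.pos.ne hia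
      · intro j hj hji
        rw [atDegree_M, if_neg, zero_mul]
        rw [Finset.mem_range] at hj
        intro hja
        rcases lt_or_gt_of_ne hji with hlt | hlt
        · have := weight_take_lt hlt hi
          omega
        · have := weight_take_lt hlt (Nat.le_of_lt_succ hj)
          omega
      · intro hi'
        rw [Finset.mem_range] at hi'
        omega
    · refine Finset.sum_eq_zero fun i hi => ?_
      rw [atDegree_M]
      split_ifs with hia
      · rw [ih _ (hdrop i), if_neg, mul_zero]
        intro hv
        rw [Finset.mem_range] at hi
        exact h (coarser_cons.2 ⟨i, Nat.le_of_lt_succ hi, hia, hv⟩)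
      · rw [zero_mul]

theorem map_parts {n : ℕ} (α : Composition n) :
    (parts α).map ((↑) : ℕ+ → ℕ) = α.blocks := by
  rw [parts, List.map_pmap]
  exact List.pmap_eq_self.2 fun _ _ => rfl

theorem weight_take_parts {n : ℕ} (α : Composition n) (i : ℕ) :
    weight ((parts α).take i) = α.sizeUpTo i := by
  rw [weight, List.map_take, map_parts, Composition.sizeUpTo]

theorem weight_parts {n : ℕ} (α : Composition n) : weight (parts α) = n := by
  rw [weight, map_parts, α.blocks_sum]

theorem length_parts {n : ℕ} (α : Composition n) : (parts α).length = α.length := by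
  rw [← List.length_map (f := ((↑) : ℕ+ → ℕ)), map_parts, Composition.length]

theorem parts_injective {n : ℕ} : Function.Injective (parts (n := n)) := by
  intro α β h
  ext1
  rw [← map_parts, ← map_parts, h]

theorem exists_parts_eq (w : List ℕ+) : ∃ α : Composition (weight w), parts α = w := by
  refine ⟨⟨w.map (↑), ?_, rfl⟩, ?_⟩
  · intro i hi
    obtain ⟨a, -, rfl⟩ := List.mem_map.1 hi
    exact a.pos
  · apply List.map_injective_iff.2 PNat.coe_injective
    rw [map_parts]

theorem boundaries_subset_iff {n : ℕ} {α β : Composition n} :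
    α.boundaries ⊆ β.boundaries ↔ Coarser (parts α) (parts β) := by
  have hmem : ∀ (γ : Composition n) (x : Fin (n + 1)),
      x ∈ γ.boundaries ↔ ∃ j, γ.sizeUpTo j = x := by
    intro γ x
    simp only [Composition.boundaries, Finset.mem_map, Finset.mem_univ, true_and]
    constructor
    · rintro ⟨j, rfl⟩
      exact ⟨j, rfl⟩
    · rintro ⟨j, hj⟩
      rcases le_total j γ.length with h | h
      · exact ⟨⟨j, Nat.lt_succ_of_le h⟩, Fin.ext hj⟩
      · refine ⟨Fin.last _, Fin.ext ?_⟩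
        rw [← hj, γ.sizeUpTo_ofLength_le j h]
        exact γ.sizeUpTo_length
  simp only [Coarser, weight_parts, weight_take_parts, true_and]
  constructor
  · intro h i
    have h1 : (⟨α.sizeUpTo i, Nat.lt_succ_of_le (α.sizeUpTo_le i)⟩ : Fin (n + 1)) ∈ α.boundaries :=
      (hmem _ _).2 ⟨i, rfl⟩
    exact (hmem _ _).1 (h h1)
  · intro h x hx
    obtain ⟨i, hi⟩ := (hmem _ _).1 hx
    obtain ⟨j, hj⟩ := h i
    exact (hmem _ _).2 ⟨j, hj.trans hi⟩

open Classical in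
theorem coord_eta {n : ℕ} (β : Composition n) (v : List ℕ+) :
    coord v (eta k β) = if Coarser v (parts β) then 2 ^ v.length else 0 := by
  rw [eta, map_sum]
  simp only [map_smul, coord_M, smul_eq_mul, mul_ite, mul_one, mul_zero]
  split_ifs with h
  · obtain ⟨α, rfl⟩ : ∃ α : Composition n, parts α = v := by
      obtain ⟨α, hα⟩ := exists_parts_eq v
      have hn : weight v = n := h.1.trans (weight_parts β)
      subst hn
      exact ⟨α, hα⟩
    rw [Finset.sum_eq_single α, if_pos rfl, length_parts]
    · intro γ _ hγ
      rw [if_neg fun h' => hγ (parts_injective h')]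
    · intro h'
      simp [boundaries_subset_iff, h] at h'
  · refine Finset.sum_eq_zero fun α hα => ?_
    rw [if_neg]
    rintro rfl
    exact h (boundaries_subset_iff.1 (Finset.mem_filter.1 hα).2)

theorem odd_parts_iff {n : ℕ} {β : Composition n} :
    (∀ a ∈ parts β, Odd (a : ℕ)) ↔ ∀ b ∈ β.blocks, Odd b := by
  rw [← map_parts]
  simp

theorem theta_M_of_odd {n : ℕ} {β : Composition n} (hβ : ∀ b ∈ β.blocks, Odd b) :
    liftBialgHom (nu (homogeneous k) (zeta k)) (M k (parts β)) = eta k β := by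
  classical
  apply ext_coord
  intro v
  rw [coord_eta, liftBialgHom_apply, coord_liftLinear]
  exact multiDegree_M_of_odd (fun w hw h0 => nu_M_of_odd hw h0) v _ (odd_parts_iff.2 hβ)

theorem span_eta_le_range {Θ : QSym k →ₐc[k] QSym k} (h : IsTheta Θ) :
    Submodule.span k (Set.range fun β : OddComposition => eta k β.1.2) ≤
      LinearMap.range (Θ : QSym k →ₗ[k] QSym k) := by
  rw [Submodule.span_le]
  rintro _ ⟨β, rfl⟩
  rw [h.unique isTheta_liftBialgHom]
  exact ⟨M k (parts β.1.2), theta_M_of_odd β.2⟩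

/-! ### Generalized Dehn–Sommerville relations -/

/-- Because Δ(C) ⊆ C ⊗ C, the functionals vanishing on `C` form a two-sided ideal for convolution;
this is the left-factor half. -/
theorem convMul_eq_zero_of_left {C : Submodule k (QSym k)}
    (hC : IsGradedSubcoalgebra (homogeneous k) C) {φ : WithConv (QSym k →ₗ[k] k)}
    (hφ : ∀ f ∈ C, φ f = 0) (ψ : WithConv (QSym k →ₗ[k] k)) : ∀ f ∈ C, (φ * ψ) f = 0 := by
  intro f hf
  obtain ⟨t, ht⟩ := hC.comul_mem f hf
  have h0 : φ.ofConv ∘ₗ C.subtype = 0 := LinearMap.ext fun x => hφ x x.2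
  rw [LinearMap.convMul_apply, ← ht, ← LinearMap.comp_apply (TensorProduct.map _ _),
    ← TensorProduct.map_comp, h0, TensorProduct.map_zero_left, LinearMap.zero_apply, map_zero]

theorem convMul_eq_zero_of_right {C : Submodule k (QSym k)}
    (hC : IsGradedSubcoalgebra (homogeneous k) C) {φ : WithConv (QSym k →ₗ[k] k)}
    (hφ : ∀ f ∈ C, φ f = 0) (ψ : WithConv (QSym k →ₗ[k] k)) : ∀ f ∈ C, (ψ * φ) f = 0 := by
  intro f hf
  obtain ⟨t, ht⟩ := hC.comul_mem f hf
  have h0 : φ.ofConv ∘ₗ C.subtype = 0 := LinearMap.ext fun x => hφ x x.2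
  rw [LinearMap.convMul_apply, ← ht, ← LinearMap.comp_apply (TensorProduct.map _ _),
    ← TensorProduct.map_comp, h0, TensorProduct.map_zero_right, LinearMap.zero_apply, map_zero]

theorem functional_sum_apply {ι : Type*} (S : Finset ι) (g : ι → WithConv (QSym k →ₗ[k] k))
    (f : QSym k) : (∑ s ∈ S, g s) f = ∑ s ∈ S, g s f := by
  induction S using Finset.cons_induction with
  | empty => rfl
  | cons a S ha ih =>
    rw [Finset.sum_cons, Finset.sum_cons, ← ih]
    rfl

theorem atDegree_eq_sum (φ : WithConv (QSym k →ₗ[k] k)) (n : ℕ) :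
    atDegree φ n = ∑ s ∈ (finite_sum_le n).toFinset with weight s = n, φ (M k s) • coord s := by
  apply functional_ext
  intro w
  rw [atDegree_M, functional_sum_apply]
  have h2 : ∀ s, (φ (M k s) • coord s : WithConv (QSym k →ₗ[k] k)) (M k w) =
      if w = s then φ (M k s) else 0 := by
    intro s
    change φ (M k s) • coord s (M k w) = _
    rw [coord_M, smul_eq_mul, mul_ite, mul_one, mul_zero]
  simp only [h2]
  rw [Finset.sum_ite_eq]
  refine if_congr ?_ rfl rfl
  rw [Finset.mem_filter, Set.Finite.mem_toFinset]
  exact ⟨fun h => ⟨h.le, h⟩, fun h => h.2⟩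

theorem coord_mul_atDegree_mul_coord (φ : WithConv (QSym k →ₗ[k] k)) (n : ℕ) (u v : List ℕ+)
    (f : QSym k) :
    (coord u * atDegree φ n * coord v : WithConv (QSym k →ₗ[k] k)) f =
      ∑ s ∈ (finite_sum_le n).toFinset with weight s = n,
        φ (M k s) * coord (u ++ s ++ v) f := by
  rw [atDegree_eq_sum, Finset.mul_sum, Finset.sum_mul]
  rw [functional_sum_apply]
  refine Finset.sum_congr rfl fun s _ => ?_
  rw [mul_smul_comm, smul_mul_assoc, ← coord_append, ← coord_append]
  rfl

theorem length_le_weight (w : List ℕ+) : w.length ≤ weight w := by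
  induction w with
  | nil => simp
  | cons a w ih =>
    rw [List.length_cons, weight_cons]
    have := a.pos
    omega

/-- The two cuts of `(a)` contribute 1 and (-1)^a = 1, while the counit contributes 0. This is the
leading coefficient of the relations below. -/
theorem barZeta_mul_zeta_M_singleton {a : ℕ+} (ha : Even (a : ℕ)) :
    (toFunctional (bar (homogeneous k) (zeta k) * zeta k) - 1) (M k [a]) = 2 := by
  change toFunctional (bar (homogeneous k) (zeta k) * zeta k) (M k [a]) -
    (1 : WithConv (QSym k →ₗ[k] k)) (M k [a]) = 2
  rw [toFunctional_mul, convMul_M, LinearMap.convOne_apply, counit_M, List.length_singleton,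
    Finset.sum_range_succ, Finset.sum_range_one]
  simp only [toFunctional_apply, bar_M, zeta_M]
  simp [ha.neg_one_pow, one_add_one_eq_two]

/-- The generalized Dehn–Sommerville relations satisfied by the odd subalgebra. -/
theorem oddSubalgebra_relation {f : QSym k} (hf : f ∈ oddSubalgebra (homogeneous k) (zeta k))
    (n : ℕ) (u v : List ℕ+) :
    ∑ s ∈ (finite_sum_le n).toFinset with weight s = n,
      (toFunctional (bar (homogeneous k) (zeta k) * zeta k) - 1) (M k s) *
        coord (u ++ s ++ v) f = 0 := by
  obtain ⟨⟨hC, hag⟩, -⟩ := isGreatest_agreement (homogeneous k) (bar (homogeneous k) (zeta k))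
    (zeta k)⁻¹
  rw [← coord_mul_atDegree_mul_coord]
  refine convMul_eq_zero_of_left hC (convMul_eq_zero_of_right hC ?_ _) _ f hf
  intro g hg
  rw [atDegree_apply]
  -- ζ̄ζ − 1 = (ζ̄ − ζ⁻¹)ζ, whose first factor vanishes on the odd subalgebra. Homogeneity of the
  -- latter then allows the passage to degree `n`.
  have h1 : toFunctional (bar (homogeneous k) (zeta k) * zeta k) - 1 =
      (toFunctional (bar (homogeneous k) (zeta k)) - toFunctional (zeta k)⁻¹) *
        toFunctional (zeta k) := by
    rw [sub_mul, ← toFunctional_mul, ← toFunctional_mul, inv_mul_cancel, toFunctional_one]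
  rw [h1]
  refine convMul_eq_zero_of_left hC ?_ _ _ (hC.isHomogeneous n hg)
  intro x hx
  exact sub_eq_zero.2 (hag x hx)

theorem two_mul_coord_of_mem_oddSubalgebra {f : QSym k}
    (hf : f ∈ oddSubalgebra (homogeneous k) (zeta k)) {a : ℕ+} (ha : Even (a : ℕ))
    (u v : List ℕ+)
    (h : ∀ s, weight s = a → 2 ≤ s.length → coord (u ++ s ++ v) f = 0) :
    2 * coord (u ++ [a] ++ v) f = 0 := by
  rw [← oddSubalgebra_relation hf a u v, Finset.sum_eq_single [a],
    barZeta_mul_zeta_M_singleton ha]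
  · intro s hs hsa
    rw [Finset.mem_filter] at hs
    rw [h s hs.2, mul_zero]
    match s with
    | [] => exact absurd hs.2 a.pos.ne
    | [b] =>
      refine absurd ?_ hsa
      have hb := hs.2
      rw [weight_cons, weight_nil, add_zero] at hb
      rw [PNat.coe_injective hb]
    | b :: c :: s => simp
  · intro h'
    refine absurd ?_ h'
    rw [Finset.mem_filter, Set.Finite.mem_toFinset]
    exact ⟨by simp, by simp⟩

/-! ### Triangularity and the basis of odd η -/

/-- Merging parts lowers their number unless nothing is merged; this makes the matrix of the η
triangular with respect to length. -/
theorem Coarser.length_le {v w : List ℕ+} (h : Coarser v w) :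
    v.length ≤ w.length ∧ (w.length ≤ v.length → v = w) := by
  induction v generalizing w with
  | nil =>
    rw [coarser_nil] at h
    subst h
    exact ⟨le_rfl, fun _ => rfl⟩
  | cons a v ih =>
    obtain ⟨i, hi, hia, hv⟩ := coarser_cons.1 h
    obtain ⟨h1, h2⟩ := ih hv
    rw [List.length_drop] at h1 h2
    have hi0 : i ≠ 0 := by
      rintro rfl
      exact a.pos.ne hia
    rw [List.length_cons]
    refine ⟨by omega, fun hle => ?_⟩
    obtain rfl : i = 1 := by omega
    rw [h2 (by omega)]
    match w with
    | [] => simp at hi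
    | b :: w =>
      simp only [List.take_succ_cons, List.take_zero, weight_cons, weight_nil, add_zero] at hia
      rw [PNat.coe_injective hia]
      rfl

theorem coarser_refl (w : List ℕ+) : Coarser w w := ⟨rfl, fun i => ⟨i, rfl⟩⟩

theorem oddComposition_ext {β γ : OddComposition} (h : parts β.1.2 = parts γ.1.2) : β = γ := by
  obtain ⟨⟨n, β⟩, hβ⟩ := β
  obtain ⟨⟨m, γ⟩, hγ⟩ := γ
  have hnm : n = m := by
    rw [← weight_parts β, ← weight_parts γ]
    exact congrArg weight h
  subst hnm
  obtain rfl : β = γ := parts_injective h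
  rfl

end CommRing

variable {k : Type*} [Field k]

theorem eq_zero_of_mem_oddSubalgebra (h2 : (2 : k) ≠ 0) {f : QSym k}
    (hf : f ∈ oddSubalgebra (homogeneous k) (zeta k))
    (h : ∀ w : List ℕ+, (∀ a ∈ w, Odd (a : ℕ)) → coord w f = 0) : f = 0 := by
  apply ext_coord
  intro w
  refine Eq.trans ?_ (map_zero _).symm
  -- Replacing an even part `a` by a composition of `a` with at least two parts keeps the weight and
  -- raises the length, so the difference drops; length never exceeds weight, so the subtraction is
  -- not truncated.
  induction hm : weight w - w.length using Nat.strong_induction_on generalizing w with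
  | _ m ih =>
    by_cases hw : ∀ a ∈ w, Odd (a : ℕ)
    · exact h w hw
    · push Not at hw
      obtain ⟨a, haw, ha⟩ := hw
      obtain ⟨u, v, rfl⟩ := List.append_of_mem haw
      rw [List.append_cons]
      refine (mul_eq_zero.1 (two_mul_coord_of_mem_oddSubalgebra hf (Nat.not_odd_iff_even.1 ha) u v
        fun s hs hs2 => ih _ ?_ _ rfl)).resolve_left h2
      have := length_le_weight (u ++ s ++ v)
      simp only [weight_append, List.length_append, weight_cons, List.length_cons] at this hm ⊢
      omega

/-- The triangular system is inverted: η_w has coordinate 2^length(v) at each `v ≤ w`, so the terms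
at strictly coarser odd `v` are subtracted and the diagonal entry is divided out. -/
theorem exists_dual_eta (h2 : (2 : k) ≠ 0) (w : List ℕ+) (hw : ∀ a ∈ w, Odd (a : ℕ)) :
    ∃ g ∈ Submodule.span k (Set.range fun β : OddComposition => eta k β.1.2),
      ∀ v : List ℕ+, (∀ a ∈ v, Odd (a : ℕ)) → coord v g = if v = w then 1 else 0 := by
  classical
  induction hm : w.length using Nat.strong_induction_on generalizing w with
  | _ m ih =>
    subst hm
    -- Filling in 0 where the induction hypothesis is silent gives a family indexed by all words,
    -- from which `choose` extracts a plain function.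
    have ih' : ∀ u : List ℕ+, ∃ g ∈ Submodule.span k
        (Set.range fun β : OddComposition => eta k β.1.2), (∀ a ∈ u, Odd (a : ℕ)) →
        u.length < w.length → ∀ v : List ℕ+, (∀ a ∈ v, Odd (a : ℕ)) →
          coord v g = if v = u then 1 else 0 := by
      intro u
      by_cases hu : (∀ a ∈ u, Odd (a : ℕ)) ∧ u.length < w.length
      · obtain ⟨g, hg, hg'⟩ := ih _ hu.2 u hu.1 rfl
        exact ⟨g, hg, fun _ _ => hg'⟩
      · exact ⟨0, Submodule.zero_mem _, fun h h' => absurd ⟨h, h'⟩ hu⟩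
    choose g hg hg' using ih'
    obtain ⟨β, hβ⟩ := exists_parts_eq w
    -- Strict coarsenings with an even part are left out because only odd coordinates are tested;
    -- the weight bound only provides finiteness.
    let S := {u ∈ (finite_sum_le (weight w)).toFinset | Coarser u w ∧ u ≠ w ∧
      ∀ a ∈ u, Odd (a : ℕ)}
    refine ⟨(2 ^ w.length : k)⁻¹ • (eta k β - ∑ u ∈ S, (2 : k) ^ u.length • g u), ?_, ?_⟩
    · refine Submodule.smul_mem _ _ (Submodule.sub_mem _ (Submodule.subset_span ?_)
        (Submodule.sum_mem _ fun u _ => Submodule.smul_mem _ _ (hg u)))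
      refine ⟨⟨⟨_, β⟩, odd_parts_iff.1 ?_⟩, rfl⟩
      rwa [hβ]
    · intro v hv
      have hsum : ∑ u ∈ S, coord v ((2 : k) ^ u.length • g u) =
          if v ∈ S then (2 : k) ^ v.length else 0 := by
        rw [← Finset.sum_ite_eq S v (fun u => (2 : k) ^ u.length)]
        refine Finset.sum_congr rfl fun u hu => ?_
        obtain ⟨-, hu1, hu2, hu3⟩ := Finset.mem_filter.1 hu
        have hlt : u.length < w.length := by
          by_contra hlt
          exact hu2 (hu1.length_le.2 (not_lt.1 hlt))
        rw [map_smul, hg' u hu3 hlt v hv, smul_eq_mul, mul_ite, mul_one, mul_zero]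
      rw [map_smul, map_sub, map_sum, hsum, coord_eta, hβ, smul_eq_mul]
      by_cases hvw : v = w
      · subst hvw
        have hS : v ∉ S := fun h => (Finset.mem_filter.1 h).2.2.1 rfl
        rw [if_pos (coarser_refl v), if_neg hS, if_pos rfl, sub_zero,
          inv_mul_cancel₀ (pow_ne_zero _ h2)]
      · have hS : v ∈ S ↔ Coarser v w := by
          rw [Finset.mem_filter, Set.Finite.mem_toFinset]
          exact ⟨fun h => h.2.1, fun h => ⟨h.1.le, h, hvw, hv⟩⟩
        rw [if_neg hvw, if_congr hS rfl rfl, sub_self, mul_zero]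

/-- A combination `x` of the dual family has the same odd coordinates as `f`. It lies in the span of
the η, hence in the odd subalgebra, so `f - x` vanishes. -/
theorem oddSubalgebra_le_span_eta (h2 : (2 : k) ≠ 0) :
    oddSubalgebra (homogeneous k) (zeta k) ≤
      Submodule.span k (Set.range fun β : OddComposition => eta k β.1.2) := by
  classical
  intro f hf
  choose! g hg hg' using exists_dual_eta (k := k) h2
  let S := {w ∈ ((basis k).repr f).support | ∀ a : ℕ+, a ∈ w → Odd (a : ℕ)}
  let x := ∑ w ∈ S, coord w f • g w
  have hx : x ∈ Submodule.span k (Set.range fun β : OddComposition => eta k β.1.2) :=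
    Submodule.sum_mem _ fun w hw => Submodule.smul_mem _ _ (hg w (Finset.mem_filter.1 hw).2)
  suffices h : f - x = 0 by
    rwa [sub_eq_zero.1 h]
  apply eq_zero_of_mem_oddSubalgebra h2
  · exact Submodule.sub_mem _ hf (range_theta_le_oddSubalgebra isTheta_liftBialgHom
      (span_eta_le_range isTheta_liftBialgHom hx))
  · intro v hv
    have hsum : ∑ w ∈ S, coord v (coord w f • g w) = if v ∈ S then coord v f else 0 := by
      rw [← Finset.sum_ite_eq S v (fun u => coord u f)]
      refine Finset.sum_congr rfl fun u hu => ?_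
      rw [map_smul, hg' u (Finset.mem_filter.1 hu).2 v hv, smul_eq_mul, mul_ite, mul_one, mul_zero]
    rw [map_sub, map_sum, hsum]
    split_ifs with h
    · exact sub_self _
    · rw [sub_zero]
      by_contra h0
      exact h (Finset.mem_filter.2 ⟨Finsupp.mem_support_iff.2 h0, hv⟩)

theorem linearIndependent_eta (h2 : (2 : k) ≠ 0) :
    LinearIndependent k (fun β : OddComposition => eta k β.1.2) := by
  classical
  rw [linearIndependent_iff]
  intro l hl
  by_contra h0
  -- For the longest β in the support, no other η_γ in the relation has a coordinate at β, since β ≤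
  -- γ with γ no longer than β forces γ = β.
  obtain ⟨β, hβ, hmax⟩ := Finset.exists_max_image l.support
    (fun β : OddComposition => (parts β.1.2).length) (Finsupp.support_nonempty_iff.2 h0)
  have h := congrArg (fun f => coord (parts β.1.2) f) hl
  simp only [Finsupp.linearCombination_apply, Finsupp.sum, map_sum, map_smul, map_zero] at h
  rw [Finset.sum_eq_single β] at h
  · rw [coord_eta, if_pos (coarser_refl _), smul_eq_mul] at h
    exact (mul_ne_zero (Finsupp.mem_support_iff.1 hβ) (pow_ne_zero _ h2)) h
  · intro γ hγ hne
    rw [coord_eta, if_neg, smul_zero]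
    intro hc
    exact hne (oddComposition_ext (hc.length_le.2 (hmax γ hγ))).symm
  · exact fun h' => absurd hβ h'

end QSym
end

theorem propositionP {k : Type*} [Field k] (hk : ringChar k ≠ 2) :
    (∃! Θ : QSym k →ₐc[k] QSym k, QSym.IsTheta Θ) ∧
    (∀ Θ : QSym k →ₐc[k] QSym k, QSym.IsTheta Θ →
      CombinatorialHopf.oddSubalgebra (QSym.homogeneous k) (QSym.zeta k) =
        LinearMap.range (Θ : QSym k →ₗ[k] QSym k)) ∧
    LinearIndependent k (fun β : QSym.OddComposition => QSym.eta k β.1.2) ∧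
    Submodule.span k (Set.range fun β : QSym.OddComposition => QSym.eta k β.1.2) =
      CombinatorialHopf.oddSubalgebra (QSym.homogeneous k) (QSym.zeta k) := by
  have h2 : (2 : k) ≠ 0 := Ring.two_ne_zero hk
  refine ⟨⟨_, QSym.isTheta_liftBialgHom, fun Θ h => h.unique QSym.isTheta_liftBialgHom⟩,
    fun Θ h => ?_, QSym.linearIndependent_eta h2, ?_⟩
  · exact le_antisymm ((QSym.oddSubalgebra_le_span_eta h2).trans (QSym.span_eta_le_range h))
      (QSym.range_theta_le_oddSubalgebra h)
  · exact le_antisymm ((QSym.span_eta_le_range QSym.isTheta_liftBialgHom).trans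
      (QSym.range_theta_le_oddSubalgebra QSym.isTheta_liftBialgHom))
      (QSym.oddSubalgebra_le_span_eta h2)
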